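/- Let $n\ge 0$ and let $\mathcal T=(\mathcal T_{ijk})_{0\le i,j,k\le n}$ be a complex tensor with $\mathcal T_{ijk}=\mathcal T_{jik}$ (a partially symmetric tensor, i.e. an element of $\mathrm{Sym}^2\mathbb C^{n+1}\otimes\mathbb C^{n+1}$). It defines the quadratic forms $q_k(x)=\sum_{i,j}\mathcal T_{ijk}x_ix_j$, $0\le k\le n$. The scheme of eigenpairs of $\mathcal T$ is $$\tilde E(\mathcal T)=V(q_0-\lambda x_0,\dots,q_n-\lambda x_n)\subset\mathbb P^{n+1}=\operatorname{Proj}\mathbb C[x_0,\dots,x_n,\lambda],$$ and the eigenscheme $E(\mathcal T)\subset\mathbb P^n$ is the closed subscheme defined by the $2\times2$ minors $x_iq_j-x_jq_i$ of the matrix with rows $(x_0,\dots,x_n)$ and $(q_0,\dots,q_n)$. For a cubic form $f\in\mathbb C[x_0,\dots,x_n]_3$ one takes $q_i=\partial f/\partial x_i$. The irregular eigenscheme $\mathrm{Irr}(f)$ is defined by the ideal $(q_0,\dots,q_n)$, and the regular eigenscheme $\mathrm{Reg}(f)$ is the residue of $E(f)$ with respect to $\mathrm{Irr}(f)$, i.e.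 the closed subscheme of $\mathbb P^n$ defined by the ideal quotient $\big((x_iq_j-x_jq_i)_{i,j}:(q_0,\dots,q_n)\big)$. The cubic $f$ is smooth if at every point of $V(f)\subset\mathbb P^n$ some partial derivative of $f$ does not vanish. Then: 1. There is a non-empty Zariski open subset of the space of partially symmetric tensors such that for every $\mathcal T$ in it the scheme $E(\mathcal T)$ consists of exactly $2^{n+1}-1$ reduced points. 2. For every partially symmetric tensor $\mathcal T$, the point $[0,\dots,0,1]$ is a smooth isolated point of $\tilde E(\mathcal T)$, and $E(\mathcal T)\neq\emptyset$. 3. In particular, every smooth cubic form $f$ has at least one regular eigenpoint: $\mathrm{Reg}(f)\ne\emptyset$, and there are a non-zero vector $v\in\mathbb C^{n+1}$ and a non-zero $c\in\mathbb C$ with $\nabla f(v)=c\,v$. -/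

import Mathlib

open AlgebraicGeometry CategoryTheory MvPolynomial

attribute [local instance] MvPolynomial.gradedAlgebra

noncomputable section

namespace Eigenscheme

/-! ### Closed subschemes of projective space over `ℂ` -/

/-- The polynomial ring `ℂ[X_s : s ∈ σ]` with its standard grading by degree. -/
abbrev polyGrading (σ : Type) : ℕ → Submodule ℂ (MvPolynomial σ ℂ) := homogeneousSubmodule σ ℂ

variable {σ : Type} (I : HomogeneousIdeal (polyGrading σ))

/-- The homogeneous coordinate ring `ℂ[X_s : s ∈ σ] / I`. -/
abbrev CoordRing : Type := MvPolynomial σ ℂ ⧸ I.toIdeal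

/-- The quotient map from the polynomial ring to the homogeneous coordinate ring. -/
abbrev toCoordRing : MvPolynomial σ ℂ →ₐ[ℂ] CoordRing I := Ideal.Quotient.mkₐ ℂ I.toIdeal

/-- The grading of the homogeneous coordinate ring: the degree `d` part consists of the classes of
the forms of degree `d`. -/
def quotGrading (d : ℕ) : Submodule ℂ (CoordRing I) :=
  (polyGrading σ d).map (toCoordRing I).toLinearMap

theorem mk_mem_quotGrading {d : ℕ} {F : MvPolynomial σ ℂ} (hF : F ∈ polyGrading σ d) :
    toCoordRing I F ∈ quotGrading I d :=
  Submodule.mem_map_of_mem (f := (toCoordRing I).toLinearMap) hF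

instance quotGradedMonoid : SetLike.GradedMonoid (quotGrading I) where
  one_mem := by
    have h := mk_mem_quotGrading I (SetLike.GradedOne.one_mem (A := polyGrading σ))
    rwa [map_one] at h
  mul_mem := by
    rintro i j _ _ ⟨F, hF, rfl⟩ ⟨G, hG, rfl⟩
    have h := mk_mem_quotGrading I (SetLike.GradedMul.mul_mem (A := polyGrading σ) hF hG)
    rwa [map_mul] at h

/-- The map from the degree `d` forms to the degree `d` part of the quotient. -/
def gradedPart (d : ℕ) : polyGrading σ d →ₗ[ℂ] quotGrading I d :=
  (toCoordRing I).toLinearMap.restrict (fun _ hF => mk_mem_quotGrading I hF)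

/-- The decomposition of a polynomial into forms, followed by passing to classes. -/
def polyDecompose : MvPolynomial σ ℂ →ₗ[ℂ] DirectSum ℕ (fun d => quotGrading I d) :=
  (DirectSum.lmap (gradedPart I)).comp (DirectSum.decomposeLinearEquiv (polyGrading σ)).toLinearMap

theorem polyDecompose_of_mem {d : ℕ} {F : MvPolynomial σ ℂ} (hF : F ∈ polyGrading σ d) :
    polyDecompose I F =
      DirectSum.lof ℂ ℕ (fun d => quotGrading I d) d
        ⟨toCoordRing I F, mk_mem_quotGrading I hF⟩ := by
  simp only [polyDecompose, LinearMap.comp_apply, LinearEquiv.coe_coe,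
    DirectSum.decomposeLinearEquiv_apply, DirectSum.decompose_of_mem _ hF]
  exact DirectSum.lmap_lof _ _ _

theorem polyDecompose_of_mem_ideal {F : MvPolynomial σ ℂ} (hF : F ∈ I.toIdeal) :
    polyDecompose I F = 0 := by
  refine DFinsupp.ext fun d => Subtype.ext ?_
  have h : toCoordRing I (DirectSum.decompose (polyGrading σ) F d : MvPolynomial σ ℂ) = 0 :=
    Ideal.Quotient.eq_zero_iff_mem.mpr (I.isHomogeneous d hF)
  exact h

/-- The decomposition of the quotient into its graded parts. -/
def quotDecompose : CoordRing I →+ DirectSum ℕ (fun d => quotGrading I d) :=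
  QuotientAddGroup.lift I.toIdeal.toAddSubgroup (polyDecompose I).toAddMonoidHom
    (fun _ hF => polyDecompose_of_mem_ideal I hF)

theorem quotDecompose_mk (F : MvPolynomial σ ℂ) :
    quotDecompose I (toCoordRing I F) = polyDecompose I F := rfl

instance quotGradedAlgebra : GradedAlgebra (quotGrading I) where
  toDecomposition := DirectSum.Decomposition.ofAddHom _ (quotDecompose I)
    (by
      refine AddMonoidHom.ext fun a => ?_
      obtain ⟨F, rfl⟩ := Ideal.Quotient.mkₐ_surjective ℂ I.toIdeal a
      simp only [AddMonoidHom.comp_apply, AddMonoidHom.id_apply, quotDecompose_mk]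
      induction F using DirectSum.Decomposition.inductionOn (polyGrading σ) with
      | zero => simp
      | homogeneous F =>
        rw [polyDecompose_of_mem I F.2]
        exact DirectSum.coeAddMonoidHom_of _ _ _
      | add F G hF hG => rw [map_add, map_add, map_add, hF, hG])
    (by
      refine DirectSum.addHom_ext fun d => ?_
      rintro ⟨_, F, hF, rfl⟩
      simp only [AddMonoidHom.comp_apply, AddMonoidHom.id_apply, DirectSum.coeAddMonoidHom_of]
      exact polyDecompose_of_mem I hF)

/-- The closed subscheme `V(I) = Proj (ℂ[X_s : s ∈ σ] / I)` of projective space cut out by a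
homogeneous ideal `I`. -/
abbrev projScheme : Scheme := Proj (quotGrading I)

/-- The structure morphism `V(I) ⟶ Spec ℂ`. -/
def structureMorphism : projScheme I ⟶ Spec (.of ℂ) :=
  Proj.toSpecZero (quotGrading I) ≫
    Spec.map (CommRingCat.ofHom (algebraMap ℂ (quotGrading I 0)))

/-- Evaluation at a vector `v` at which all elements of `I` vanish, on the homogeneous coordinate
ring. -/
def evalAt (v : σ → ℂ) (hI : ∀ F ∈ I, eval v F = 0) : CoordRing I →+* ℂ :=
  Ideal.Quotient.lift I.toIdeal (eval v) hI

/-- The closed point `[v]` of `V(I)`, for a non-zero vector `v` at which all elements of `I` vanish: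
the homogeneous prime ideal generated by all homogeneous elements vanishing at `v`. -/
def pointOf (v : σ → ℂ) (hv : v ≠ 0) (hI : ∀ F ∈ I, eval v F = 0) : projScheme I :=
  show ProjectiveSpectrum (quotGrading I) from
  { asHomogeneousIdeal := (RingHom.ker (evalAt I v hI)).homogeneousCore (quotGrading I)
    isPrime := (RingHom.ker_isPrime (evalAt I v hI)).homogeneousCore
    not_irrelevant_le := by
      intro h
      obtain ⟨s, hs⟩ := Function.ne_iff.mp hv
      have h1 : toCoordRing I (X s) ∈ HomogeneousIdeal.irrelevant (quotGrading I) :=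
        HomogeneousIdeal.mem_irrelevant_of_mem _ one_pos
          (mk_mem_quotGrading I (isHomogeneous_X ℂ s))
      have h2 := Ideal.toIdeal_homogeneousCore_le (quotGrading I) _ (h h1)
      have h3 : evalAt I v hI (toCoordRing I (X s)) = 0 := h2
      have h4 : evalAt I v hI (toCoordRing I (X s)) = v s := by
        simp [evalAt]
      exact hs (h4 ▸ h3) }

/-- A scheme `X` over `Y` is smooth at the point `x` if the structure morphism is smooth on an open
neighbourhood of `x`. -/
def IsSmoothAt {X Y : Scheme} (f : X ⟶ Y) (x : X) : Prop :=
  ∃ U : X.Opens, x ∈ U ∧ Smooth (U.ι ≫ f)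

/-- The scheme `X` consists of `N` reduced points: it is reduced and its underlying topological
space is discrete with exactly `N` points. -/
def ConsistsOfReducedPoints (X : Scheme) (N : ℕ) : Prop :=
  IsReduced X ∧ DiscreteTopology X ∧ Finite X ∧ Nat.card X = N

/-- The ideal quotient `(I : J)` of homogeneous ideals. -/
def colonIdeal (J : HomogeneousIdeal (polyGrading σ)) : HomogeneousIdeal (polyGrading σ) where
  toSubmodule := I.toIdeal.colon (J.toIdeal : Set (MvPolynomial σ ℂ))
  is_homogeneous' := by
    classical
    intro i r hr
    rw [Submodule.mem_colon] at hr ⊢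
    intro s hs
    rw [← DirectSum.sum_support_decompose (polyGrading σ) s, Finset.smul_sum]
    refine Submodule.sum_mem _ fun j _ => ?_
    have h1 := I.isHomogeneous (i + j) (hr _ (J.isHomogeneous j hs))
    rwa [smul_eq_mul, DirectSum.coe_decompose_mul_add_of_right_mem _ (SetLike.coe_mem _)] at h1

/-! ### Partially symmetric tensors -/

/-- The quadratic forms in `x₀, …, xₙ`. -/
abbrev Quadric (n : ℕ) : Type := homogeneousSubmodule (Fin (n + 1)) ℂ 2

/-- Partially symmetric tensors, the elements of `Sym² ℂⁿ⁺¹ ⊗ ℂⁿ⁺¹`: tensors of format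
`(n+1) × (n+1) × (n+1)` that are symmetric in the first two indices. -/
def PartiallySymmetricTensor (n : ℕ) : Type :=
  {T : Fin (n + 1) → Fin (n + 1) → Fin (n + 1) → ℂ // ∀ i j k, T i j k = T j i k}

/-- The quadratic forms `qₖ = ∑ᵢⱼ Tᵢⱼₖ xᵢ xⱼ`, the coordinates of the contraction
`T · (x ⊗ x)`. -/
def PartiallySymmetricTensor.quadrics {n : ℕ} (T : PartiallySymmetricTensor n) (k : Fin (n + 1)) :
    Quadric n :=
  ⟨∑ i, ∑ j, C (T.1 i j k) * (X i * X j), by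
    refine Submodule.sum_mem _ fun i _ => Submodule.sum_mem _ fun j _ => ?_
    rw [← smul_eq_C_mul]
    exact Submodule.smul_mem _ _ ((isHomogeneous_X ℂ i).mul (isHomogeneous_X ℂ j))⟩

/-- A property holds for the general partially symmetric tensor if it holds on a non-empty Zariski
open subset of the space of these tensors: outside the zero set of a polynomial in the entries which
is not identically zero on the space. -/
def HoldsForGeneral (n : ℕ) (P : PartiallySymmetricTensor n → Prop) : Prop :=
  ∃ D : MvPolynomial (Fin (n + 1) × Fin (n + 1) × Fin (n + 1)) ℂ,
    (∃ T : PartiallySymmetricTensor n, eval (fun a => T.1 a.1 a.2.1 a.2.2) D ≠ 0) ∧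
    ∀ T : PartiallySymmetricTensor n, eval (fun a => T.1 a.1 a.2.1 a.2.2) D ≠ 0 → P T

/-! ### Eigenschemes of tuples of quadratic forms -/

variable {n : ℕ} (q : Fin (n + 1) → Quadric n)

/-- The ideal `(q₀ - λ x₀, …, qₙ - λ xₙ)` of `ℂ[x₀, …, xₙ, λ]`, where `λ` is the last variable. -/
def eigenpairIdeal : HomogeneousIdeal (polyGrading (Fin (n + 2))) where
  toSubmodule := Ideal.span (Set.range fun i : Fin (n + 1) =>
    rename Fin.castSucc (q i : MvPolynomial (Fin (n + 1)) ℂ) -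
      X (Fin.last (n + 1)) * X i.castSucc)
  is_homogeneous' := Ideal.homogeneous_span _ _ (by
    rintro _ ⟨i, rfl⟩
    exact ⟨2, Submodule.sub_mem _ (IsHomogeneous.rename_isHomogeneous (q i).2)
      ((isHomogeneous_X ℂ _).mul (isHomogeneous_X ℂ _))⟩)

/-- The scheme of eigenpairs `Ẽ = V(q₀ - λ x₀, …, qₙ - λ xₙ) ⊂ ℙⁿ⁺¹`. -/
abbrev eigenpairScheme : Scheme := projScheme (eigenpairIdeal q)

/-- The vector `(0, …, 0, 1)`. -/
def lastVec (n : ℕ) : Fin (n + 2) → ℂ := Pi.single (Fin.last (n + 1)) 1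

theorem lastVec_ne_zero (n : ℕ) : lastVec n ≠ 0 := by
  simp [lastVec]

theorem eval_lastVec (F : MvPolynomial (Fin (n + 2)) ℂ) (hF : F ∈ eigenpairIdeal q) :
    eval (lastVec n) F = 0 := by
  have hle : (eigenpairIdeal q).toIdeal ≤ RingHom.ker (eval (lastVec n)) := by
    refine Ideal.span_le.mpr ?_
    rintro _ ⟨i, rfl⟩
    have hz : lastVec n ∘ Fin.castSucc = 0 := by
      funext j
      simp [lastVec, Fin.castSucc_ne_last]
    have hc : constantCoeff (q i : MvPolynomial (Fin (n + 1)) ℂ) = 0 := by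
      have h := IsHomogeneous.coeff_eq_zero (q i).2 (d := 0) (by simp)
      simpa [← constantCoeff_eq] using h
    have hi : lastVec n i.castSucc = 0 := congrFun hz i
    simp [RingHom.mem_ker, eval_rename, hz, hi, hc]
  exact hle hF

/-- The point `[0, …, 0, 1]` of the scheme of eigenpairs. -/
def lastPoint : eigenpairScheme q :=
  pointOf (eigenpairIdeal q) (lastVec n) (lastVec_ne_zero n) (eval_lastVec q)

/-- The ideal of the `2 × 2` minors of the matrix with rows `(x₀, …, xₙ)` and `(q₀, …, qₙ)`. -/
def minorsIdeal : HomogeneousIdeal (polyGrading (Fin (n + 1))) where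
  toSubmodule := Ideal.span (Set.range fun p : Fin (n + 1) × Fin (n + 1) =>
    X p.1 * (q p.2 : MvPolynomial (Fin (n + 1)) ℂ) - X p.2 * (q p.1 : MvPolynomial _ ℂ))
  is_homogeneous' := Ideal.homogeneous_span _ _ (by
    rintro _ ⟨p, rfl⟩
    exact ⟨1 + 2, Submodule.sub_mem _ ((isHomogeneous_X ℂ _).mul (q p.2).2)
      ((isHomogeneous_X ℂ _).mul (q p.1).2)⟩)

/-- The eigenscheme `E ⊂ ℙⁿ`, the common vanishing scheme of these minors. -/
abbrev eigenscheme : Scheme := projScheme (minorsIdeal q)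

/-- The ideal `(q₀, …, qₙ)` of the irregular eigenscheme. -/
def irregularIdeal : HomogeneousIdeal (polyGrading (Fin (n + 1))) where
  toSubmodule := Ideal.span (Set.range fun i : Fin (n + 1) => (q i : MvPolynomial (Fin (n + 1)) ℂ))
  is_homogeneous' := Ideal.homogeneous_span _ _ (by
    rintro _ ⟨i, rfl⟩
    exact ⟨2, (q i).2⟩)

/-- The regular eigenscheme: the residue of the eigenscheme with respect to the irregular
eigenscheme, with ideal the ideal quotient of the two ideals. -/
abbrev regularEigenscheme : Scheme := projScheme (colonIdeal (minorsIdeal q) (irregularIdeal q))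

/-- The tuple `(∂f/∂x₀, …, ∂f/∂xₙ)` of quadratic forms of a cubic form `f`. -/
def gradient (f : homogeneousSubmodule (Fin (n + 1)) ℂ 3) (i : Fin (n + 1)) : Quadric n :=
  ⟨pderiv i (f : MvPolynomial (Fin (n + 1)) ℂ), IsHomogeneous.pderiv f.2⟩

/-- The cubic `f` is smooth: at every point of the hypersurface `V(f) ⊂ ℙⁿ` some partial derivative
of `f` does not vanish. -/
def IsSmoothCubic (f : homogeneousSubmodule (Fin (n + 1)) ℂ 3) : Prop :=
  ∀ v : Fin (n + 1) → ℂ, v ≠ 0 → eval v (f : MvPolynomial (Fin (n + 1)) ℂ) = 0 →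
    ∃ i, eval v (pderiv i (f : MvPolynomial (Fin (n + 1)) ℂ)) ≠ 0

end Eigenscheme

end

/-!
Write `q(x)` for the quadratic map defined by a tensor. If the quadrics `qₖ` have no non-trivial
common zero, every eigenvector can be rescaled to satisfy `q(x) = x`, and the rescaled vector is
unique. So the eigenpoints are the non-zero solutions of the affine system `qₖ(x) = xₖ`, and the
eigenscheme is studied through the algebra `R[x] / (qₖ - xₖ)` of fixed points, over any base ring
`R`.

*Counting.* The fixed points of the tensor with `qₖ = xₖ²` are the `2ⁿ⁺¹` vectors with entries `0`
and `1`. To propagate this count, consider the universal tensor. Where a Macaulay determinant is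
invertible, the `qₖ` have no non-trivial common zero and the fixed point algebra is finite over the
base (`finite_fixedPointAlgebra`), being spanned by monomials of bounded degree. Where the Jacobian
determinant is invertible in the algebra it is étale (`etale_fixedPointAlgebra`). At the tensor with
`qₖ = xₖ²` the first is `1` and the square of the second is `1`, and by Nakayama's lemma both are
invertible over a principal open neighbourhood of this tensor (`exists_dvd_fixedPointJacobian`). A
finite étale algebra over a domain has constant rank, and over an algebraically closed field the
rank is the number of points, so there are `2ⁿ⁺¹` fixed points over the whole neighbourhood, and the
algebra of fixed points is reduced there (`exists_polynomial_fixedPoints`).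

*From fixed points to the eigenscheme.* By the Nullstellensatz the points of the eigenscheme are the
lines through the non-zero fixed points (`eigenpoint_surjective`). A nilpotent function on the chart
`xₛ ≠ 0` gives, after multiplication by `xₛ`, a form lying in the radical ideal `(qₖ - xₖ)`; the
substitution `x ↦ x / λ` with `λ = qₛ / xₛ` turns this into the vanishing of the function, so the
eigenscheme is reduced (`isReduced_eigenscheme`).

*The point `[0, …, 0, 1]`.* Write `q(x) = Q(x) x` with a matrix `Q(x)` of linear forms. On the
scheme of eigenpairs `(λ - Q(x)) x = 0`, so `det (λ - Q(x))` annihilates all `xᵢ`, and the open set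
where it does not vanish is a copy of `Spec ℂ` (`bijective_away_pencilDet`).

*Existence.* An arbitrary tensor is a limit of general ones along a line, and a limit of unit
eigenvectors is a unit eigenvector (`exists_eigenvector`). For a smooth cubic, Euler's formula shows
that the gradient vanishes at no non-zero vector, so an eigenvector has a non-zero eigenvalue, and
it is a point of the regular eigenscheme.
-/

noncomputable section

namespace Eigenscheme

/-! ### The scheme of fixed points of a quadratic map -/

section FixedPoints

variable {ι : Type} [Fintype ι] {R S : Type} [CommRing R] [CommRing S]

/-- The quadratic form `qₖ = ∑ᵢⱼ tᵢⱼₖ xᵢ xⱼ` of a not necessarily symmetric tensor `t` with entries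
in a commutative ring. -/
def contraction (t : ι × ι × ι → R) (k : ι) : MvPolynomial ι R :=
  ∑ i, ∑ j, C (t (i, j, k)) * (X i * X j)

/-- The equation `qₖ - xₖ` of the fixed points of `x ↦ q(x)`. -/
def fixedPointEq (t : ι × ι × ι → R) (k : ι) : MvPolynomial ι R :=
  contraction t k - X k

/-- The coordinate ring `R[x] / (qₖ - xₖ)` of the scheme of fixed points of `x ↦ q(x)`. -/
abbrev FixedPointAlgebra (t : ι × ι × ι → R) : Type :=
  MvPolynomial ι R ⧸ Ideal.span (Set.range (fixedPointEq t))

/-- The Jacobian determinant of the equations `qₖ - xₖ`. -/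
def fixedPointJacobian [DecidableEq ι] (t : ι × ι × ι → R) : MvPolynomial ι R :=
  (Matrix.of fun i j => pderiv i (fixedPointEq t j)).det

theorem contraction_isHomogeneous (t : ι × ι × ι → R) (k : ι) :
    (contraction t k).IsHomogeneous 2 := by
  refine IsHomogeneous.sum _ _ _ fun i _ => IsHomogeneous.sum _ _ _ fun j _ => ?_
  have h := (isHomogeneous_C ι (t (i, j, k))).mul ((isHomogeneous_X R i).mul (isHomogeneous_X R j))
  simpa using h

theorem map_contraction (φ : R →+* S) (t : ι × ι × ι → R) (k : ι) :
    map φ (contraction t k) = contraction (φ ∘ t) k := by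
  simp [contraction]

theorem map_fixedPointEq (φ : R →+* S) (t : ι × ι × ι → R) (k : ι) :
    map φ (fixedPointEq t k) = fixedPointEq (φ ∘ t) k := by
  simp [fixedPointEq, map_contraction]

theorem map_fixedPointJacobian [DecidableEq ι] (φ : R →+* S) (t : ι × ι × ι → R) :
    map φ (fixedPointJacobian t) = fixedPointJacobian (φ ∘ t) := by
  rw [fixedPointJacobian, fixedPointJacobian, RingHom.map_det]
  congr 1
  ext1 i j
  simp [← map_fixedPointEq, pderiv_map]

theorem eval_contraction (t : ι × ι × ι → R) (k : ι) (v : ι → R) :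
    eval v (contraction t k) = ∑ i, ∑ j, t (i, j, k) * (v i * v j) := by
  simp [contraction]

theorem map_span_fixedPointEq (φ : R →+* S) (t : ι × ι × ι → R) :
    (Ideal.span (Set.range (fixedPointEq t))).map (map φ) =
      Ideal.span (Set.range (fixedPointEq (φ ∘ t))) := by
  rw [Ideal.map_span, ← Set.range_comp]
  congr 2
  funext k
  exact map_fixedPointEq φ t k

/-- The Jacobian criterion for the scheme of fixed points. -/
theorem etale_fixedPointAlgebra [DecidableEq ι] (t : ι × ι × ι → R)
    (h : IsUnit (Ideal.Quotient.mk (Ideal.span (Set.range (fixedPointEq t)))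
      (fixedPointJacobian t))) :
    Algebra.Etale R (FixedPointAlgebra t) := by
  let P : Algebra.PreSubmersivePresentation R (FixedPointAlgebra t) ι ι :=
    Algebra.PreSubmersivePresentation.naive (v := fixedPointEq t) id Function.injective_id
  have hP : IsUnit P.jacobian := by
    rw [Algebra.PreSubmersivePresentation.jacobian_eq_jacobiMatrix_det]
    have h1 : P.jacobiMatrix = Matrix.of fun i j => pderiv i (fixedPointEq t j) := by
      ext1 i j
      exact Algebra.PreSubmersivePresentation.jacobiMatrix_naive _ _ _ _ i j
    rw [h1]
    exact h
  let Q : Algebra.SubmersivePresentation R (FixedPointAlgebra t) ι ι :=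
    { P with jacobian_isUnit := hP }
  have : Algebra.IsStandardSmoothOfRelativeDimension 0 R (FixedPointAlgebra t) :=
    Q.isStandardSmoothOfRelativeDimension (by simp [Algebra.Presentation.dimension])
  exact Algebra.Etale.iff_isStandardSmoothOfRelativeDimension_zero.mpr this

/-! ### Finiteness of the scheme of fixed points -/

/-- The exponents of the monomials of degree `#ι + 1`, the smallest degree in which every monomial
is divisible by the square of a variable. -/
abbrev TopExponent (ι : Type) [Fintype ι] : Type :=
  {m : ι →₀ ℕ // m.degree = Fintype.card ι + 1}

instance : Finite (TopExponent ι) :=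
  (Finsupp.finite_of_degree_le (σ := ι) (Fintype.card ι + 1)).subset fun _ h => le_of_eq h

instance : Fintype (TopExponent ι) := Fintype.ofFinite _

theorem TopExponent.exists_two_le (m : TopExponent ι) : ∃ i, 2 ≤ m.1 i := by
  by_contra! h
  have h1 : m.1.degree ≤ ∑ _i : ι, 1 := by
    rw [Finsupp.degree_eq_sum]
    exact Finset.sum_le_sum fun i _ => by have := h i; omega
  have h2 := m.2
  simp at h1
  omega

/-- A variable whose square divides the monomial. -/
def TopExponent.index (m : TopExponent ι) : ι := m.exists_two_le.choose

/-- The exponent of the quotient of the monomial by the square of the variable `m.index`. -/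
def TopExponent.rest (m : TopExponent ι) : ι →₀ ℕ := m.1 - Finsupp.single m.index 2

theorem TopExponent.rest_add (m : TopExponent ι) : m.rest + Finsupp.single m.index 2 = m.1 := by
  refine tsub_add_cancel_of_le ?_
  rw [Finsupp.single_le_iff]
  exact m.exists_two_le.choose_spec

theorem TopExponent.degree_rest (m : TopExponent ι) : m.rest.degree + 1 = Fintype.card ι := by
  have h := congrArg Finsupp.degree m.rest_add
  rw [map_add, Finsupp.degree_single, m.2] at h
  omega

/-- The matrix expressing the multiples `x^(m - 2eᵢ) qᵢ` of the quadrics through the monomials of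
degree `#ι + 1`. Its determinant is a multiple of the resultant of the quadrics. -/
def macaulayMatrix (t : ι × ι × ι → R) : Matrix (TopExponent ι) (TopExponent ι) R :=
  fun m m' => coeff m'.1 (monomial m.rest 1 * contraction t m.index)

theorem macaulayMatrix_map (φ : R →+* S) (t : ι × ι × ι → R) :
    (macaulayMatrix t).map φ = macaulayMatrix (φ ∘ t) := by
  ext m m'
  simp only [Matrix.map_apply, macaulayMatrix, ← coeff_map, map_mul, map_monomial, map_one,
    map_contraction]

theorem sum_macaulayMatrix (t : ι × ι × ι → R) (m : TopExponent ι) :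
    ∑ m', C (macaulayMatrix t m m') * monomial m'.1 1 =
      monomial m.rest 1 * contraction t m.index := by
  classical
  ext d
  have hh : (monomial m.rest (1 : R) * contraction t m.index).IsHomogeneous
      (Fintype.card ι + 1) := by
    have h := (isHomogeneous_monomial (R := R) (d := m.rest) 1 rfl).mul
      (contraction_isHomogeneous t m.index)
    rwa [show m.rest.degree + 2 = Fintype.card ι + 1 by have := m.degree_rest; omega] at h
  simp only [coeff_sum, coeff_C_mul, coeff_monomial]
  by_cases hd : d.degree = Fintype.card ι + 1
  · rw [Finset.sum_eq_single ⟨d, hd⟩]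
    · simp [macaulayMatrix]
    · intro b _ hb
      rw [if_neg (fun h => hb (Subtype.ext h)), mul_zero]
    · simp
  · rw [hh.coeff_eq_zero hd]
    refine Finset.sum_eq_zero fun b _ => ?_
    rw [if_neg (fun h => hd (by rw [← h]; exact b.2)), mul_zero]

/-- Cramer's rule: up to the Macaulay determinant, every monomial of degree `#ι + 1` is an explicit
combination of the quadrics. -/
theorem det_macaulayMatrix_mul_monomial [DecidableEq ι] (t : ι × ι × ι → R) (m : TopExponent ι) :
    C (macaulayMatrix t).det * monomial m.1 1 =
      ∑ m', C ((macaulayMatrix t).adjugate m m') *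
        (monomial m'.rest 1 * contraction t m'.index) := by
  simp only [← sum_macaulayMatrix, Finset.mul_sum]
  rw [Finset.sum_comm]
  simp only [← mul_assoc, ← Finset.sum_mul, ← C_mul, ← map_sum]
  have h := Matrix.adjugate_mul (macaulayMatrix t)
  have h1 : ∀ m'', ∑ m', (macaulayMatrix t).adjugate m m' * macaulayMatrix t m' m'' =
      if m = m'' then (macaulayMatrix t).det else 0 := fun m'' => by
    rw [← Matrix.mul_apply, h, Matrix.smul_apply, Matrix.one_apply]
    simp
  simp only [h1]
  rw [Finset.sum_eq_single m]
  · rw [if_pos rfl]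
  · intro b _ hb
    rw [if_neg hb.symm, map_zero, zero_mul]
  · simp

theorem eq_zero_of_contraction_eq_zero [DecidableEq ι] [IsDomain R] (t : ι × ι × ι → R)
    (ht : (macaulayMatrix t).det ≠ 0) (v : ι → R) (hv : ∀ k, eval v (contraction t k) = 0) :
    v = 0 := by
  funext i
  have h := congrArg (eval v) (det_macaulayMatrix_mul_monomial t
    ⟨Finsupp.single i (Fintype.card ι + 1), Finsupp.degree_single _ _⟩)
  simp only [map_mul, map_sum, hv, mul_zero, Finset.sum_const_zero, eval_C] at h
  have h1 := (mul_eq_zero.mp h).resolve_left ht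
  rw [eval_monomial, one_mul, Finsupp.prod_single_index (by exact pow_zero _)] at h1
  exact eq_zero_of_pow_eq_zero h1

theorem finite_fixedPointAlgebra [DecidableEq ι] (t : ι × ι × ι → R)
    (ht : IsUnit (macaulayMatrix t).det) : Module.Finite R (FixedPointAlgebra t) := by
  let I := Ideal.span (Set.range (fixedPointEq t))
  let s : Set (FixedPointAlgebra t) :=
    (fun m : ι →₀ ℕ => Ideal.Quotient.mk I (monomial m 1)) '' {m | m.degree ≤ Fintype.card ι}
  have hs : s.Finite := (Finsupp.finite_of_degree_le _).image _
  let N : Submodule R (FixedPointAlgebra t) := Submodule.span R s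
  have hmem : ∀ m : ι →₀ ℕ, m.degree ≤ Fintype.card ι → Ideal.Quotient.mk I (monomial m 1) ∈ N :=
    fun m hm => Submodule.subset_span ⟨m, hm, rfl⟩
  have hC : ∀ (a : R) (p : MvPolynomial ι R),
      Ideal.Quotient.mk I (C a * p) = a • Ideal.Quotient.mk I p := by
    intro a p
    rw [← smul_eq_C_mul]
    rfl
  have hrel : ∀ k, Ideal.Quotient.mk I (contraction t k) = Ideal.Quotient.mk I (X k) := fun k =>
    Ideal.Quotient.eq.mpr (Ideal.subset_span ⟨k, rfl⟩)
  have htop : ∀ m : TopExponent ι, Ideal.Quotient.mk I (monomial m.1 1) ∈ N := by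
    intro m
    have h := congrArg (Ideal.Quotient.mk I) (det_macaulayMatrix_mul_monomial t m)
    rw [hC] at h
    obtain ⟨u, hu⟩ := ht
    have h2 : Ideal.Quotient.mk I (monomial m.1 1) = (↑u⁻¹ : R) •
        ((macaulayMatrix t).det • Ideal.Quotient.mk I (monomial m.1 1)) := by
      rw [smul_smul, ← hu, Units.inv_mul, one_smul]
    rw [h2, h, map_sum]
    refine N.smul_mem _ (N.sum_mem fun m' _ => ?_)
    rw [hC, map_mul, hrel, ← map_mul]
    refine N.smul_mem _ ?_
    rw [X, monomial_mul, one_mul]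
    refine hmem _ ?_
    rw [map_add, Finsupp.degree_single, m'.degree_rest]
  have hX : ∀ i, ∀ a ∈ N, a * Ideal.Quotient.mk I (X i) ∈ N := by
    intro i a ha
    induction ha using Submodule.span_induction with
    | mem a ha =>
      obtain ⟨m, hm, rfl⟩ := ha
      simp only [← map_mul, X, monomial_mul, one_mul]
      have hdeg : (m + Finsupp.single i 1).degree = m.degree + 1 := by
        rw [map_add, Finsupp.degree_single]
      rcases Nat.lt_or_ge m.degree (Fintype.card ι) with h | h
      · exact hmem _ (by omega)
      · exact htop ⟨m + Finsupp.single i 1, by have : m.degree ≤ _ := hm; omega⟩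
    | zero => simp
    | add a b _ _ ha hb => rw [add_mul]; exact N.add_mem ha hb
    | smul r a _ ha => rw [smul_mul_assoc]; exact N.smul_mem r ha
  refine ⟨⟨hs.toFinset, ?_⟩⟩
  rw [hs.coe_toFinset, eq_top_iff]
  rintro a -
  obtain ⟨p, rfl⟩ := Ideal.Quotient.mk_surjective a
  change Ideal.Quotient.mk I p ∈ N
  induction p using MvPolynomial.induction_on with
  | C a =>
    have h := hC a 1
    rw [mul_one] at h
    rw [h]
    exact N.smul_mem _ (hmem 0 (by simp))
  | add p q hp hq => rw [map_add]; exact N.add_mem hp hq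
  | mul_X p i hp => rw [map_mul]; exact hX i _ hp

end FixedPoints

/-! ### Counting fixed points in a finite étale family -/

section Counting

variable {ι : Type} [Fintype ι]

/-- The fixed points of `x ↦ q(x)`. -/
def fixedPoints {K : Type} [CommRing K] (t : ι × ι × ι → K) : Set (ι → K) :=
  {v | ∀ k, eval v (contraction t k) = v k}

/-- Over a finite étale algebra, the number of geometric points in a fibre is the rank. -/
theorem natCard_algHom_eq_rankAtStalk {R B K : Type} [CommRing R] [CommRing B] [Algebra R B]
    [Field K] [IsAlgClosed K] [Algebra R K] [Module.Finite R B] [Algebra.Etale R B] :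
    Nat.card (B →ₐ[R] K) = Module.rankAtStalk (R := R) B
      ((⊥ : PrimeSpectrum K).comap (algebraMap R K)) := by
  classical
  let E := TensorProduct R K B
  have hfin : Finite (PrimeSpectrum E) := by
    have : IsArtinianRing E := isArtinian_of_tower K inferInstance
    infer_instance
  have e : E ≃ₐ[K] (PrimeSpectrum E → K) := Algebra.FormallyEtale.equivPiOfIsSepClosed K E
  have h1 : Module.finrank K E = Nat.card (PrimeSpectrum E) := by
    have := Fintype.ofFinite (PrimeSpectrum E)
    rw [e.toLinearEquiv.finrank_eq, Module.finrank_pi, Nat.card_eq_fintype_card]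
  have h2 : Nat.card ((PrimeSpectrum E → K) →ₐ[K] K) = Nat.card (PrimeSpectrum E) := by
    refine (Nat.card_eq_of_bijective (fun p => Pi.evalAlgHom K (fun _ => K) p) ⟨?_, ?_⟩).symm
    · intro p p' h
      by_contra hne
      have := DFunLike.congr_fun h (Pi.single p 1)
      simp [Ne.symm hne] at this
    · intro φ
      obtain ⟨s, hs⟩ := AlgHom.eq_piEvalAlgHom φ
      exact ⟨s, hs.symm⟩
  have h3 : Nat.card (B →ₐ[R] K) = Nat.card (E →ₐ[K] K) :=
    Nat.card_congr (Algebra.TensorProduct.liftEquivRight R K B K)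
  have h4 : Nat.card (E →ₐ[K] K) = Nat.card ((PrimeSpectrum E → K) →ₐ[K] K) :=
    Nat.card_congr (e.arrowCongr AlgEquiv.refl)
  rw [h3, h4, h2, ← h1, ← Module.rankAtStalk_baseChange, Module.rankAtStalk_eq_finrank_of_free]
  rfl

theorem natCard_algHom_fixedPointAlgebra {R K : Type} [CommRing R] [CommRing K] [Algebra R K]
    (t : ι × ι × ι → R) :
    Nat.card (FixedPointAlgebra t →ₐ[R] K) = Nat.card (fixedPoints (algebraMap R K ∘ t)) := by
  have hev : ∀ (v : ι → K) (p : MvPolynomial ι R),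
      aeval v p = eval v (map (algebraMap R K) p) := fun v p => by
    rw [MvPolynomial.eval_map, aeval_def]
  have hrel : ∀ v : ι → K, v ∈ fixedPoints (algebraMap R K ∘ t) ↔
      ∀ k, aeval v (fixedPointEq t k) = 0 := fun v => by
    simp only [hev, map_fixedPointEq]
    simp [fixedPoints, fixedPointEq, sub_eq_zero]
  refine Nat.card_congr ⟨fun φ => ⟨fun i => φ (Ideal.Quotient.mk _ (X i)), ?_⟩,
    fun v => Ideal.Quotient.liftₐ _ (aeval v.1) ?_, ?_, ?_⟩
  · rw [hrel]
    intro k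
    have h : (aeval fun i => φ (Ideal.Quotient.mk _ (X i)) : MvPolynomial ι R →ₐ[R] K) =
        φ.comp (Ideal.Quotient.mkₐ R _) := by
      ext i
      simp
    rw [h]
    have h0 : Ideal.Quotient.mk (Ideal.span (Set.range (fixedPointEq t))) (fixedPointEq t k) = 0 :=
      Ideal.Quotient.eq_zero_iff_mem.mpr (Ideal.subset_span ⟨k, rfl⟩)
    simp [h0]
  · intro a ha
    have hle : Ideal.span (Set.range (fixedPointEq t)) ≤ RingHom.ker (aeval v.1) := by
      rw [Ideal.span_le]
      rintro _ ⟨k, rfl⟩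
      exact (hrel v.1).mp v.2 k
    exact hle ha
  · intro φ
    apply Ideal.Quotient.algHom_ext
    ext i
    exact aeval_X _ i
  · intro v
    ext i
    exact aeval_X _ i

/-- The number of fixed points is the same at any two geometric points of a connected base over
which the scheme of fixed points is finite étale. -/
theorem natCard_fixedPoints_eq [DecidableEq ι] {R K : Type} [CommRing R] [IsDomain R]
    [IsNoetherianRing R] [Field K] [IsAlgClosed K] (t : ι × ι × ι → R)
    (ht : IsUnit (macaulayMatrix t).det)
    (hJ : IsUnit (Ideal.Quotient.mk (Ideal.span (Set.range (fixedPointEq t)))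
      (fixedPointJacobian t))) (φ ψ : R →+* K) :
    Nat.card (fixedPoints (φ ∘ t)) = Nat.card (fixedPoints (ψ ∘ t)) := by
  have := finite_fixedPointAlgebra t ht
  have := etale_fixedPointAlgebra t hJ
  have := Module.finitePresentation_of_finite R (FixedPointAlgebra t)
  have hflat : Module.Flat R (FixedPointAlgebra t) := inferInstance
  have hconst : ∀ p p' : PrimeSpectrum R, Module.rankAtStalk (FixedPointAlgebra t) p =
      Module.rankAtStalk (FixedPointAlgebra t) p' := fun p p' =>
    Module.isLocallyConstant_rankAtStalk.apply_eq_of_isPreconnected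
      isPreconnected_univ (Set.mem_univ p) (Set.mem_univ p')
  have key : ∀ χ : R →+* K, ∃ p, Nat.card (fixedPoints (χ ∘ t)) =
      Module.rankAtStalk (FixedPointAlgebra t) p := fun χ => by
    let := χ.toAlgebra
    refine ⟨_, Eq.trans ?_
      (natCard_algHom_eq_rankAtStalk (R := R) (B := FixedPointAlgebra t) (K := K))⟩
    exact (natCard_algHom_fixedPointAlgebra (K := K) t).symm
  obtain ⟨p, hp⟩ := key φ
  obtain ⟨p', hp'⟩ := key ψ
  rw [hp, hp', hconst]

end Counting

/-! ### Fixed points of the general quadratic map -/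

section General

variable {ι : Type} [Fintype ι] [DecidableEq ι]

/-- The tensor with `qₖ = xₖ²`. -/
def diagonalTensor (ι R : Type) [DecidableEq ι] [CommRing R] (a : ι × ι × ι) : R :=
  if a.1 = a.2.2 ∧ a.2.1 = a.2.2 then 1 else 0

theorem contraction_diagonalTensor (R : Type) [CommRing R] (k : ι) :
    contraction (diagonalTensor ι R) k = X k ^ 2 := by
  rw [contraction, Finset.sum_eq_single k, Finset.sum_eq_single k]
  · simp [diagonalTensor, sq]
  · intro j _ hj
    simp [diagonalTensor, hj]
  · simp
  · intro i _ hi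
    refine Finset.sum_eq_zero fun j _ => ?_
    simp [diagonalTensor, hi]
  · simp

theorem macaulayMatrix_diagonalTensor (R : Type) [CommRing R] :
    macaulayMatrix (diagonalTensor ι R) = 1 := by
  ext m m'
  rw [macaulayMatrix, contraction_diagonalTensor, X_pow_eq_monomial, monomial_mul, m.rest_add,
    one_mul, coeff_monomial, Matrix.one_apply]
  simp only [Subtype.ext_iff]

/-- For the tensor with `qₖ = xₖ²` the fixed points are nondegenerate: the square of the Jacobian
determinant `∏ₖ (2xₖ - 1)` is `1` on the scheme of fixed points. -/
theorem fixedPointJacobian_diagonalTensor_sq_sub_one_mem (R : Type) [CommRing R] :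
    fixedPointJacobian (diagonalTensor ι R) ^ 2 - 1 ∈
      Ideal.span (Set.range (fixedPointEq (diagonalTensor ι R))) := by
  have h : (Matrix.of fun i j => pderiv i (fixedPointEq (diagonalTensor ι R) j)) =
      Matrix.diagonal fun i => 2 * X i - 1 := by
    ext1 i j
    simp only [Matrix.of_apply, fixedPointEq, contraction_diagonalTensor, Matrix.diagonal_apply]
    split_ifs with hij
    · subst hij
      simp
    · simp [pderiv_X_of_ne (Ne.symm hij)]
  rw [fixedPointJacobian, h, Matrix.det_diagonal, ← Finset.prod_pow, ← Ideal.Quotient.eq, map_prod,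
    map_one]
  refine Finset.prod_eq_one fun k _ => ?_
  rw [← map_one (Ideal.Quotient.mk _), Ideal.Quotient.eq]
  have h1 : (2 * X k - 1 : MvPolynomial ι R) ^ 2 - 1 =
      4 * fixedPointEq (diagonalTensor ι R) k := by
    rw [fixedPointEq, contraction_diagonalTensor]
    ring
  rw [h1]
  exact Ideal.mul_mem_left _ _ (Ideal.subset_span ⟨k, rfl⟩)

theorem natCard_fixedPoints_diagonalTensor (K : Type) [Field K] :
    Nat.card (fixedPoints (diagonalTensor ι K)) = 2 ^ Fintype.card ι := by
  have h : fixedPoints (diagonalTensor ι K) = Set.pi Set.univ fun _ => {0, 1} := by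
    ext v
    simp only [fixedPoints, contraction_diagonalTensor, Set.mem_ofPred_eq, Set.mem_pi, Set.mem_univ,
      true_imp_iff, Set.mem_insert_iff, Set.mem_singleton_iff, map_pow, eval_X]
    refine forall_congr' fun k => ?_
    constructor
    · intro hk
      have : v k * (v k - 1) = 0 := by linear_combination hk
      rcases mul_eq_zero.mp this with h | h
      · exact Or.inl h
      · exact Or.inr (sub_eq_zero.mp h)
    · rintro (hk | hk) <;> simp [hk]
  rw [h, Nat.card_congr (Equiv.Set.univPi _), Nat.card_pi]
  simp [Nat.card_coe_set_eq]

/-- An element of a finite algebra whose square is `1` over a point of the base is invertible over a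
principal neighbourhood of the point. -/
theorem exists_dvd_algebraMap {R A : Type} [CommRing R] [CommRing A] [Algebra R A]
    [Module.Finite R A] (𝔪 : Ideal R) (J : A) (hJ : J ^ 2 - 1 ∈ 𝔪.map (algebraMap R A)) :
    ∃ r : R, r - 1 ∈ 𝔪 ∧ J ∣ algebraMap R A r := by
  have h2 : 𝔪.map (algebraMap R (A ⧸ Ideal.span {J})) = ⊤ := by
    rw [Ideal.eq_top_iff_one]
    have h3 := Ideal.mem_map_of_mem (Ideal.Quotient.mk (Ideal.span {J})) hJ
    have hJ0 : Ideal.Quotient.mk (Ideal.span {J}) J = 0 :=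
      Ideal.Quotient.eq_zero_iff_mem.mpr (Ideal.mem_span_singleton_self J)
    rw [Ideal.map_map, map_sub, map_pow, hJ0, map_one, zero_pow two_ne_zero, zero_sub,
      neg_mem_iff] at h3
    exact h3
  obtain ⟨r, hr, hr'⟩ := Submodule.exists_sub_one_mem_and_smul_eq_zero_of_fg_of_le_smul 𝔪
    (⊤ : Submodule R (A ⧸ Ideal.span {J})) Module.Finite.fg_top (by
      rw [Ideal.smul_top_eq_map, h2]
      exact fun _ _ => trivial)
  refine ⟨r, hr, ?_⟩
  have h1 := hr' 1 trivial
  rw [Algebra.smul_def, mul_one] at h1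
  exact Ideal.mem_span_singleton.mp (Ideal.Quotient.eq_zero_iff_mem.mp h1)

/-- If the scheme of fixed points is finite over `R` and the square of the Jacobian determinant is
`1` over a point of the base, then this determinant is invertible over a principal neighbourhood of
the point. -/
theorem exists_dvd_fixedPointJacobian {R K : Type} [CommRing R] [Field K] (t : ι × ι × ι → R)
    [Module.Finite R (FixedPointAlgebra t)] (φ : R →+* K) (hφ : Function.Surjective φ)
    (h : fixedPointJacobian (φ ∘ t) ^ 2 - 1 ∈ Ideal.span (Set.range (fixedPointEq (φ ∘ t)))) :
    ∃ r : R, φ r = 1 ∧ Ideal.Quotient.mk (Ideal.span (Set.range (fixedPointEq t)))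
      (fixedPointJacobian t) ∣ algebraMap R (FixedPointAlgebra t) r := by
  rw [← map_fixedPointJacobian, ← map_span_fixedPointEq, ← map_one (map φ), ← map_pow,
    ← map_sub, Ideal.mem_map_iff_of_surjective _ (map_surjective φ hφ)] at h
  obtain ⟨a, ha, h⟩ := h
  have hk : fixedPointJacobian t ^ 2 - 1 - a ∈ (RingHom.ker φ).map C := by
    rw [← ker_map, RingHom.mem_ker, map_sub, h, sub_self]
  have hk' := Ideal.mem_map_of_mem
    (Ideal.Quotient.mk (Ideal.span (Set.range (fixedPointEq t)))) hk
  rw [Ideal.map_map, map_sub, Ideal.Quotient.eq_zero_iff_mem.mpr ha, sub_zero, map_sub, map_pow,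
    map_one] at hk'
  obtain ⟨r, hr, hJ⟩ := exists_dvd_algebraMap (RingHom.ker φ) _ hk'
  refine ⟨r, ?_, hJ⟩
  rwa [RingHom.mem_ker, map_sub, map_one, sub_eq_zero] at hr

/-- The universal tensor. -/
abbrev universalTensor (ι : Type) (a : ι × ι × ι) : MvPolynomial (ι × ι × ι) ℂ := X a

/-- For the general tensor the quadrics have no non-trivial common zero, the map `x ↦ q(x)` has
`2 ^ #ι` fixed points and the scheme of fixed points is reduced. -/
theorem exists_polynomial_fixedPoints (ι : Type) [Fintype ι] [DecidableEq ι] :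
    ∃ D : MvPolynomial (ι × ι × ι) ℂ, eval (diagonalTensor ι ℂ) D ≠ 0 ∧
      ∀ t : ι × ι × ι → ℂ, eval t D ≠ 0 →
        (∀ v : ι → ℂ, (∀ k, eval v (contraction t k) = 0) → v = 0) ∧
        Nat.card (fixedPoints t) = 2 ^ Fintype.card ι ∧
        IsReduced (FixedPointAlgebra t) := by
  let P := MvPolynomial (ι × ι × ι) ℂ
  let f : P := (macaulayMatrix (universalTensor ι)).det
  have hf : ∀ t, eval t f = (macaulayMatrix t).det := fun t => by
    rw [RingHom.map_det, RingHom.mapMatrix_apply, macaulayMatrix_map]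
    congr 2
    funext a
    simp
  have hf0 : eval (diagonalTensor ι ℂ) f = 1 := by
    rw [hf, macaulayMatrix_diagonalTensor, Matrix.det_one]
  -- Specialization at a tensor outside the zero locus of `f`.
  let Pf := Localization.Away f
  let sp (t : ι × ι × ι → ℂ) (ht : eval t f ≠ 0) : Pf →+* ℂ :=
    IsLocalization.Away.lift f (g := eval t) (isUnit_iff_ne_zero.mpr ht)
  have hsp : ∀ t ht p, sp t ht (algebraMap P Pf p) = eval t p := fun t ht p =>
    IsLocalization.Away.lift_eq f _ p
  let u : ι × ι × ι → Pf := algebraMap P Pf ∘ universalTensor ι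
  have hu : ∀ t ht, sp t ht ∘ u = t := fun t ht => by
    funext a
    change sp t ht (algebraMap P Pf (X a)) = t a
    exact (hsp t ht _).trans (eval_X a)
  have hdet : IsUnit (macaulayMatrix u).det := by
    have h := IsLocalization.Away.algebraMap_isUnit (S := Pf) f
    rwa [RingHom.map_det, RingHom.mapMatrix_apply, macaulayMatrix_map] at h
  have hd0 : eval (diagonalTensor ι ℂ) f ≠ 0 := by rw [hf0]; exact one_ne_zero
  have hfin := finite_fixedPointAlgebra u hdet
  obtain ⟨r, hr, hJr⟩ := exists_dvd_fixedPointJacobian u (sp _ hd0)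
    (fun c => ⟨algebraMap P Pf (C c), (hsp _ hd0 _).trans (eval_C c)⟩)
    (by rw [hu _ hd0]; exact fixedPointJacobian_diagonalTensor_sq_sub_one_mem ℂ)
  obtain ⟨k, g, hg⟩ := IsLocalization.Away.surj f r
  have hfr : ∀ t ht, sp t ht r * eval t f ^ k = eval t g := fun t ht => by
    rw [← hsp t ht, ← hsp t ht, ← hg, map_mul, map_pow]
  have hlift : ∀ t, eval t (f * g) ≠ 0 → ∃ ht : eval t f ≠ 0, sp t ht r ≠ 0 := fun t h => by
    rw [map_mul] at h
    refine ⟨left_ne_zero_of_mul h, fun h0 => right_ne_zero_of_mul h ?_⟩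
    rw [← hfr t (left_ne_zero_of_mul h), h0, zero_mul]
  have hD0 : eval (diagonalTensor ι ℂ) (f * g) ≠ 0 := by
    rw [map_mul, ← hfr _ hd0, hr, hf0]
    simp
  refine ⟨f * g, hD0, fun t ht => ?_⟩
  -- The scheme of fixed points is finite étale over the domain `R`.
  let R := Localization.Away r
  have hdomf : IsDomain Pf := IsLocalization.isDomain_localization
    (powers_le_nonZeroDivisors_of_noZeroDivisors (fun h => hd0 (by rw [h, map_zero])))
  have hdom : IsDomain R := IsLocalization.isDomain_localization
    (powers_le_nonZeroDivisors_of_noZeroDivisors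
      (fun h => one_ne_zero (by rw [← hr, h, map_zero])))
  have hnoethf : IsNoetherianRing Pf :=
    IsLocalization.isNoetherianRing (Submonoid.powers f) _ inferInstance
  have hnoeth : IsNoetherianRing R :=
    IsLocalization.isNoetherianRing (Submonoid.powers r) _ hnoethf
  let w : ι × ι × ι → R := algebraMap Pf R ∘ u
  have hdetw : IsUnit (macaulayMatrix w).det := by
    have h := hdet.map (algebraMap Pf R)
    rwa [RingHom.map_det, RingHom.mapMatrix_apply, macaulayMatrix_map] at h
  have hJ : ∀ {S : Type} [CommRing S] (ψ : Pf →+* S) (hψ : IsUnit (ψ r)),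
      IsUnit (Ideal.Quotient.mk (Ideal.span (Set.range (fixedPointEq (ψ ∘ u))))
        (fixedPointJacobian (ψ ∘ u))) := by
    intro S _ ψ hψ
    let Ψ : FixedPointAlgebra u →+* FixedPointAlgebra (ψ ∘ u) :=
      Ideal.quotientMap _ (map ψ) (Ideal.map_le_iff_le_comap.mp (map_span_fixedPointEq ψ u).le)
    have h := map_dvd Ψ hJr
    have h1 : Ψ (Ideal.Quotient.mk _ (fixedPointJacobian u)) =
        Ideal.Quotient.mk _ (fixedPointJacobian (ψ ∘ u)) := by
      rw [Ideal.quotientMap_mk, map_fixedPointJacobian]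
    have h2 : Ψ (algebraMap Pf _ r) = algebraMap S _ (ψ r) := by
      change Ψ (Ideal.Quotient.mk _ (C r)) = Ideal.Quotient.mk _ (C (ψ r))
      rw [Ideal.quotientMap_mk, map_C]
    rw [h1, h2] at h
    exact isUnit_of_dvd_unit h (hψ.map _)
  have hJw := hJ (algebraMap Pf R) (IsLocalization.Away.algebraMap_isUnit r)
  have hpoint : ∀ t, eval t (f * g) ≠ 0 → ∃ χ : R →+* ℂ, χ ∘ w = t := fun t h => by
    obtain ⟨ht, hrt⟩ := hlift t h
    refine ⟨IsLocalization.Away.lift r (g := sp t ht) (isUnit_iff_ne_zero.mpr hrt), ?_⟩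
    funext a
    exact (IsLocalization.Away.lift_eq r _ _).trans (congrFun (hu t ht) a)
  refine ⟨fun v hv => ?_, ?_, ?_⟩
  · refine eq_zero_of_contraction_eq_zero t ?_ v hv
    rw [← hf]
    exact (hlift t ht).choose
  · obtain ⟨χ, hχ⟩ := hpoint t ht
    obtain ⟨χ₀, hχ₀⟩ := hpoint _ hD0
    rw [← hχ, natCard_fixedPoints_eq w hdetw hJw χ χ₀, hχ₀, natCard_fixedPoints_diagonalTensor]
  · obtain ⟨ht', hrt⟩ := hlift t ht
    have h := hJ (sp t ht') (isUnit_iff_ne_zero.mpr hrt)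
    rw [hu t ht'] at h
    have := etale_fixedPointAlgebra t h
    exact Algebra.FormallyUnramified.isReduced_of_field ℂ _

end General

/-! ### Points of projective schemes -/

section Proj

theorem aeval_mul_of_isHomogeneous {σ A : Type} [CommRing A] [Algebra ℂ A] {d : ℕ}
    {F : MvPolynomial σ ℂ} (hF : F.IsHomogeneous d) (c : A) (v : σ → A) :
    aeval (fun s => c * v s) F = c ^ d * aeval v F := by
  rw [aeval_def, eval₂_eq, aeval_def, eval₂_eq, Finset.mul_sum]
  refine Finset.sum_congr rfl fun m hm => ?_
  have hd : m.degree = d := by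
    by_contra h
    exact mem_support_iff.mp hm (hF.coeff_eq_zero h)
  simp only [mul_pow, Finset.prod_mul_distrib, Finset.prod_pow_eq_pow_sum]
  rw [← hd, Finsupp.degree_apply]
  ring

theorem eval_smul_of_isHomogeneous {σ : Type} {d : ℕ} {F : MvPolynomial σ ℂ}
    (hF : F.IsHomogeneous d) (c : ℂ) (v : σ → ℂ) : eval (c • v) F = c ^ d * eval v F := by
  have h := aeval_mul_of_isHomogeneous hF c v
  rwa [aeval_eq_eval, aeval_eq_eval] at h

variable {σ : Type} (I : HomogeneousIdeal (polyGrading σ))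

theorem exists_form_of_mem_quotGrading {d : ℕ} {a : CoordRing I} (ha : a ∈ quotGrading I d) :
    ∃ F ∈ polyGrading σ d, toCoordRing I F = a := by
  obtain ⟨F, hF, rfl⟩ := ha
  exact ⟨F, hF, rfl⟩

theorem toCoordRing_eq_zero_iff (F : MvPolynomial σ ℂ) : toCoordRing I F = 0 ↔ F ∈ I.toIdeal :=
  Ideal.Quotient.eq_zero_iff_mem

theorem homogeneousIdeal_le_of_forms {J K : HomogeneousIdeal (quotGrading I)}
    (h : ∀ d, ∀ F ∈ polyGrading σ d, toCoordRing I F ∈ J → toCoordRing I F ∈ K) : J ≤ K := by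
  classical
  intro a ha
  rw [← DirectSum.sum_support_decompose (quotGrading I) a]
  refine Ideal.sum_mem K.toIdeal fun d _ => ?_
  have h1 := J.isHomogeneous d ha
  obtain ⟨F, hF, hFa⟩ := exists_form_of_mem_quotGrading I
    (SetLike.coe_mem (DirectSum.decompose (quotGrading I) a d))
  rw [← hFa] at h1 ⊢
  exact h d F hF h1

theorem mem_pointOf_iff {v : σ → ℂ} (hv : v ≠ 0) (hI : ∀ F ∈ I, eval v F = 0) {d : ℕ}
    {F : MvPolynomial σ ℂ} (hF : F ∈ polyGrading σ d) :
    toCoordRing I F ∈ (pointOf I v hv hI).asHomogeneousIdeal ↔ eval v F = 0 := by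
  change toCoordRing I F ∈ (RingHom.ker (evalAt I v hI)).homogeneousCore (quotGrading I) ↔ _
  constructor
  · intro h
    exact Ideal.toIdeal_homogeneousCore_le (quotGrading I) _ h
  · intro h
    exact Ideal.mem_homogeneousCore_of_homogeneous_of_mem ⟨d, mk_mem_quotGrading I hF⟩ h

theorem irrelevant_le_span_X :
    (HomogeneousIdeal.irrelevant (quotGrading I)).toIdeal ≤
      Ideal.span (Set.range fun s => toCoordRing I (X s)) := by
  classical
  intro a ha
  rw [← DirectSum.sum_support_decompose (quotGrading I) a]
  refine Ideal.sum_mem _ fun d _ => ?_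
  rcases Nat.eq_zero_or_pos d with rfl | hd
  · have h0 : (DirectSum.decompose (quotGrading I) a 0 : CoordRing I) = 0 := ha
    rw [h0]
    exact zero_mem _
  · obtain ⟨F, hF, hFa⟩ := exists_form_of_mem_quotGrading I
      (SetLike.coe_mem (DirectSum.decompose (quotGrading I) a d))
    rw [← hFa]
    have h1 : F ∈ idealOfVars σ ℂ := by
      rw [← pow_one (idealOfVars σ ℂ), mem_pow_idealOfVars_iff']
      intro x hx
      exact IsHomogeneous.coeff_eq_zero hF (by omega)
    have h2 := Ideal.mem_map_of_mem (toCoordRing I) h1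
    rw [idealOfVars, Ideal.map_span, ← Set.range_comp] at h2
    exact h2

theorem exists_X_notMem (p : projScheme I) :
    ∃ s, toCoordRing I (X s) ∉ p.asHomogeneousIdeal := by
  by_contra! h
  refine p.not_irrelevant_le ((irrelevant_le_span_X I).trans ?_)
  rw [Ideal.span_le]
  rintro _ ⟨s, rfl⟩
  exact h s

/-- A point of `V(I)` whose ideal contains all forms vanishing at `v` is the point `[v]`. -/
theorem eq_pointOf {v : σ → ℂ} (hv : v ≠ 0) (hI : ∀ F ∈ I, eval v F = 0) (p : projScheme I)
    (hp : ∀ d, ∀ F ∈ polyGrading σ d, eval v F = 0 → toCoordRing I F ∈ p.asHomogeneousIdeal) :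
    p = pointOf I v hv hI := by
  have hprime := p.isPrime
  refine ProjectiveSpectrum.ext (le_antisymm ?_ ?_)
  · refine homogeneousIdeal_le_of_forms I fun d F hF hFp => ?_
    rw [mem_pointOf_iff I hv hI hF]
    by_contra hFv
    obtain ⟨s, hs⟩ := exists_X_notMem I p
    -- The form `vₛᵈ F - F(v) xₛᵈ` vanishes at `v`.
    have h1 := hp d (C (v s ^ d) * F - C (eval v F) * X s ^ d)
      (Submodule.sub_mem _ (by
        rw [← smul_eq_C_mul]
        exact Submodule.smul_mem _ _ hF) (by
        rw [← smul_eq_C_mul]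
        exact Submodule.smul_mem _ _ (isHomogeneous_X_pow s d))) (by simp [mul_comm])
    rw [map_sub, map_mul, map_mul] at h1
    have h2 : toCoordRing I (C (eval v F)) * toCoordRing I (X s ^ d) ∈
        p.asHomogeneousIdeal.toIdeal := by
      have h3 := Ideal.sub_mem p.asHomogeneousIdeal.toIdeal
        (Ideal.mul_mem_left _ (toCoordRing I (C (v s ^ d))) hFp) h1
      rwa [sub_sub_cancel] at h3
    rcases hprime.mem_or_mem h2 with h3 | h3
    · refine hprime.ne_top (Ideal.eq_top_of_isUnit_mem _ h3 ?_)
      exact ((isUnit_iff_ne_zero.mpr hFv).map C).map (toCoordRing I)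
    · rw [map_pow] at h3
      exact hs (hprime.mem_of_pow_mem _ h3)
  · refine homogeneousIdeal_le_of_forms I fun d F hF hFp => ?_
    exact hp d F hF ((mem_pointOf_iff I hv hI hF).mp hFp)

end Proj

/-! ### Points of the eigenscheme and normalized eigenvectors -/

section Points

variable {n : ℕ} (q : Fin (n + 1) → Quadric n)

theorem eval_eq_zero_of_mem_minorsIdeal {v : Fin (n + 1) → ℂ}
    (hv : ∀ i j, v i * eval v (q j : MvPolynomial (Fin (n + 1)) ℂ) =
      v j * eval v (q i : MvPolynomial (Fin (n + 1)) ℂ)) :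
    ∀ F ∈ minorsIdeal q, eval v F = 0 := by
  have hle : (minorsIdeal q).toIdeal ≤ RingHom.ker (eval v) := by
    refine Ideal.span_le.mpr ?_
    rintro _ ⟨p, rfl⟩
    simp [RingHom.mem_ker, hv p.1 p.2]
  exact hle

theorem minor_mem_minorsIdeal (i j : Fin (n + 1)) :
    X i * (q j : MvPolynomial (Fin (n + 1)) ℂ) - X j * (q i : MvPolynomial (Fin (n + 1)) ℂ) ∈
      (minorsIdeal q).toIdeal :=
  Ideal.subset_span ⟨(i, j), rfl⟩

/-- The non-zero fixed points of `x ↦ q(x)`: the representatives of the eigenpoints with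
eigenvalue `1`. -/
def normalizedEigenvectors : Set (Fin (n + 1) → ℂ) :=
  {v | v ≠ 0 ∧ ∀ k, eval v (q k : MvPolynomial (Fin (n + 1)) ℂ) = v k}

theorem eval_eq_zero_of_mem_normalizedEigenvectors {v : Fin (n + 1) → ℂ}
    (hv : v ∈ normalizedEigenvectors q) : ∀ F ∈ minorsIdeal q, eval v F = 0 :=
  eval_eq_zero_of_mem_minorsIdeal q fun i j => by rw [hv.2, hv.2, mul_comm]

/-- The point of the eigenscheme spanned by a normalized eigenvector. -/
def eigenpoint (v : normalizedEigenvectors q) : eigenscheme q :=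
  pointOf (minorsIdeal q) v.1 v.2.1 (eval_eq_zero_of_mem_normalizedEigenvectors q v.2)

theorem exists_smul_of_mul_eq_mul {v w : Fin (n + 1) → ℂ} (hv : v ≠ 0)
    (h : ∀ i j, v i * w j = v j * w i) : ∃ c : ℂ, w = c • v := by
  obtain ⟨i, hi⟩ := Function.ne_iff.mp hv
  refine ⟨w i / v i, ?_⟩
  funext j
  have hi' : v i ≠ 0 := hi
  simp only [Pi.smul_apply, smul_eq_mul]
  field_simp
  rw [mul_comm (w j), h, mul_comm]

theorem eigenpoint_injective : Function.Injective (eigenpoint q) := by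
  intro v w h
  obtain ⟨c, hc⟩ := exists_smul_of_mul_eq_mul (w := w.1) v.2.1 (fun i j => by
    have hF : C (v.1 i) * X j - C (v.1 j) * X i ∈ polyGrading (Fin (n + 1)) 1 := by
      rw [← smul_eq_C_mul, ← smul_eq_C_mul]
      exact Submodule.sub_mem _ (Submodule.smul_mem _ _ (isHomogeneous_X ℂ _))
        (Submodule.smul_mem _ _ (isHomogeneous_X ℂ _))
    have h1 : toCoordRing (minorsIdeal q) (C (v.1 i) * X j - C (v.1 j) * X i) ∈
        (eigenpoint q v).asHomogeneousIdeal :=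
      (mem_pointOf_iff _ _ _ hF).mpr (by simp [mul_comm])
    rw [h] at h1
    have h2 := (mem_pointOf_iff _ _ _ hF).mp h1
    simpa [sub_eq_zero] using h2)
  obtain ⟨i, hi⟩ := Function.ne_iff.mp w.2.1
  have h1 := w.2.2 i
  rw [hc, eval_smul_of_isHomogeneous (q i).2, v.2.2, Pi.smul_apply, smul_eq_mul] at h1
  have hi' : c * v.1 i ≠ 0 := by
    have : w.1 i ≠ 0 := hi
    rwa [hc] at this
  have hc1 : c = 1 := by
    have h2 : (c * v.1 i) * (c - 1) = 0 := by linear_combination h1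
    exact sub_eq_zero.mp ((mul_eq_zero.mp h2).resolve_left hi')
  exact Subtype.ext (by rw [hc, hc1, one_smul])

/-- If the quadrics have no non-trivial common zero, every eigenvector is proportional to a
normalized one. -/
theorem exists_smul_mem_normalizedEigenvectors
    (h0 : ∀ v : Fin (n + 1) → ℂ,
      (∀ k, eval v (q k : MvPolynomial (Fin (n + 1)) ℂ) = 0) → v = 0)
    {w : Fin (n + 1) → ℂ} (hw : w ≠ 0) (hI : ∀ F ∈ minorsIdeal q, eval w F = 0) :
    ∃ c : ℂ, ∃ v ∈ normalizedEigenvectors q, w = c • v := by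
  obtain ⟨c, hc⟩ := exists_smul_of_mul_eq_mul
    (w := fun k => eval w (q k : MvPolynomial (Fin (n + 1)) ℂ)) hw (fun i j => by
      have := hI _ (minor_mem_minorsIdeal q i j)
      simpa [sub_eq_zero] using this)
  have hc0 : c ≠ 0 := by
    rintro rfl
    refine hw (h0 w fun k => ?_)
    simpa using congrFun hc k
  refine ⟨c, c⁻¹ • w, ⟨smul_ne_zero (inv_ne_zero hc0) hw, fun k => ?_⟩, ?_⟩
  · rw [eval_smul_of_isHomogeneous (q k).2]
    have := congrFun hc k
    simp only [Pi.smul_apply, smul_eq_mul] at this ⊢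
    rw [this]
    field_simp
  · rw [smul_smul, mul_inv_cancel₀ hc0, one_smul]

/-- By the Nullstellensatz the ideal of a point contains all forms vanishing at one of the finitely
many eigenvectors. -/
theorem eigenpoint_surjective [Finite (normalizedEigenvectors q)]
    (h0 : ∀ v : Fin (n + 1) → ℂ,
      (∀ k, eval v (q k : MvPolynomial (Fin (n + 1)) ℂ) = 0) → v = 0) :
    Function.Surjective (eigenpoint q) := by
  classical
  have := Fintype.ofFinite (normalizedEigenvectors q)
  intro p
  have hprime := p.isPrime
  suffices h : ∃ v : normalizedEigenvectors q, ∀ d, ∀ F ∈ polyGrading (Fin (n + 1)) d,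
      eval v.1 F = 0 → toCoordRing (minorsIdeal q) F ∈ p.asHomogeneousIdeal by
    obtain ⟨v, hv⟩ := h
    exact ⟨v, (eq_pointOf _ _ _ p hv).symm⟩
  by_contra! h
  choose d F hF hFv hFp using h
  obtain ⟨s, hs⟩ := exists_X_notMem _ p
  have hG : X s * ∏ v, F v ∈ (minorsIdeal q).toIdeal.radical := by
    rw [← vanishingIdeal_zeroLocus_eq_radical (K := ℂ), mem_vanishingIdeal_iff]
    intro w hw
    rw [map_mul, map_prod, aeval_X]
    by_cases hw0 : w = 0
    · simp [hw0]
    obtain ⟨c, v, hv, rfl⟩ := exists_smul_mem_normalizedEigenvectors q h0 hw0 (fun F hF => by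
      simpa [aeval_eq_eval] using hw F hF)
    rw [Finset.prod_eq_zero (Finset.mem_univ ⟨v, hv⟩), mul_zero]
    rw [aeval_eq_eval, eval_smul_of_isHomogeneous (hF _)]
    exact mul_eq_zero_of_right _ (hFv ⟨v, hv⟩)
  obtain ⟨k, hk⟩ := hG
  rw [← toCoordRing_eq_zero_iff] at hk
  have h1 : toCoordRing (minorsIdeal q) ((X s * ∏ v, F v) ^ k) ∈ p.asHomogeneousIdeal.toIdeal := by
    rw [hk]
    exact zero_mem _
  rw [map_pow] at h1
  have h2 := hprime.mem_of_pow_mem _ h1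
  rw [map_mul, map_prod] at h2
  rcases hprime.mem_or_mem h2 with h3 | h3
  · exact hs h3
  · obtain ⟨v, -, hv⟩ := hprime.prod_mem_iff.mp h3
    exact hFp v hv

theorem t1Space_eigenscheme (h : Function.Surjective (eigenpoint q)) :
    T1Space (eigenscheme q) := by
  refine t1Space_iff_specializes_imp_eq.mpr fun x y hxy => ?_
  obtain ⟨v, rfl⟩ := h x
  have hle : (eigenpoint q v).asHomogeneousIdeal ≤ y.asHomogeneousIdeal :=
    (ProjectiveSpectrum.le_iff_mem_closure (𝒜 := quotGrading (minorsIdeal q)) (eigenpoint q v)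
      y).mpr (specializes_iff_mem_closure.mp hxy)
  refine (eq_pointOf _ _ _ y fun d F hF hFv => hle ?_).symm
  exact (mem_pointOf_iff _ _ _ hF).mpr hFv

end Points

/-! ### Reducedness of the eigenscheme -/

section Reduced

variable {n : ℕ} (q : Fin (n + 1) → Quadric n)

theorem minorsIdeal_le_span_fixedPointEq (t : Fin (n + 1) × Fin (n + 1) × Fin (n + 1) → ℂ)
    (hq : ∀ k, (q k : MvPolynomial (Fin (n + 1)) ℂ) = contraction t k) :
    (minorsIdeal q).toIdeal ≤ Ideal.span (Set.range (fixedPointEq t)) := by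
  refine Ideal.span_le.mpr ?_
  rintro _ ⟨⟨i, j⟩, rfl⟩
  have h : X i * contraction t j - X j * contraction t i =
      X i * fixedPointEq t j - X j * fixedPointEq t i := by
    simp only [fixedPointEq]
    ring
  simp only [hq, h]
  exact sub_mem (Ideal.mul_mem_left _ _ (Ideal.subset_span ⟨j, rfl⟩))
    (Ideal.mul_mem_left _ _ (Ideal.subset_span ⟨i, rfl⟩))

/-- On the eigenscheme `q = λ x` for the section `λ = qₛ / xₛ`, and `λ` is invertible where `xₛ` is
if the quadrics have no non-trivial common zero. -/
theorem exists_X_pow_sub_mul_mem_minorsIdeal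
    (h0 : ∀ v : Fin (n + 1) → ℂ,
      (∀ k, eval v (q k : MvPolynomial (Fin (n + 1)) ℂ) = 0) → v = 0) (s : Fin (n + 1)) :
    ∃ N b, X s ^ N - b * (q s : MvPolynomial (Fin (n + 1)) ℂ) ∈ (minorsIdeal q).toIdeal := by
  have hrad : (X s : MvPolynomial (Fin (n + 1)) ℂ) ∈ (Ideal.span
      (Set.range fun k => (q k : MvPolynomial (Fin (n + 1)) ℂ))).radical := by
    rw [← vanishingIdeal_zeroLocus_eq_radical (K := ℂ), mem_vanishingIdeal_iff]
    intro w hw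
    have hw0 : w = 0 := h0 w fun k => by
      simpa [aeval_eq_eval] using hw _ (Ideal.subset_span ⟨k, rfl⟩)
    simp [hw0]
  obtain ⟨N, hN⟩ := hrad
  obtain ⟨c, hc⟩ := (Ideal.mem_span_range_iff_exists_fun).mp hN
  refine ⟨N + 1, ∑ k, c k * X k, ?_⟩
  have h : X s ^ (N + 1) - (∑ k, c k * X k) * (q s : MvPolynomial (Fin (n + 1)) ℂ) =
      ∑ k, c k * (X s * (q k : MvPolynomial (Fin (n + 1)) ℂ) -
        X k * (q s : MvPolynomial (Fin (n + 1)) ℂ)) := by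
    rw [pow_succ, ← hc, Finset.sum_mul, Finset.sum_mul, ← Finset.sum_sub_distrib]
    refine Finset.sum_congr rfl fun k _ => ?_
    ring
  rw [h]
  exact Ideal.sum_mem _ fun k _ => Ideal.mul_mem_left _ _ (minor_mem_minorsIdeal q s k)

/-- Homogenization of the equations of the fixed points: the substitution `x ↦ x / λ` with
`λ = qₛ / xₛ` maps the equations `qₖ - xₖ` to zero on the eigenscheme. -/
theorem exists_pow_mul_mem_minorsIdeal (t : Fin (n + 1) × Fin (n + 1) × Fin (n + 1) → ℂ)
    (hq : ∀ k, (q k : MvPolynomial (Fin (n + 1)) ℂ) = contraction t k) (s : Fin (n + 1)) {d : ℕ}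
    {F : MvPolynomial (Fin (n + 1)) ℂ} (hF : F.IsHomogeneous d)
    (hFt : F ∈ Ideal.span (Set.range (fixedPointEq t))) :
    ∃ M, (q s : MvPolynomial (Fin (n + 1)) ℂ) ^ M * (X s ^ d * F) ∈ (minorsIdeal q).toIdeal := by
  let A := CoordRing (minorsIdeal q)
  let π := toCoordRing (minorsIdeal q)
  let Q : A := π (q s)
  let L := Localization.Away Q
  let ρ : MvPolynomial (Fin (n + 1)) ℂ →ₐ[ℂ] L := (IsScalarTower.toAlgHom ℂ A L).comp π
  have hρ : ∀ G, ρ G = aeval (fun k => ρ (X k)) G := fun G => by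
    rw [← comp_aeval_apply, aeval_X_left_apply]
  have hρπ : ∀ G, ρ G = algebraMap A L (π G) := fun G => rfl
  let μ : L := IsLocalization.Away.invSelf Q
  have hμ : ρ (q s) * μ = 1 := IsLocalization.Away.mul_invSelf Q
  let c : L := ρ (X s) * μ
  have hminor : ∀ k, ρ (X s) * ρ (q k) = ρ (X k) * ρ (q s) := fun k => by
    rw [← sub_eq_zero, ← map_mul, ← map_mul, ← map_sub, hρπ,
      (toCoordRing_eq_zero_iff _ _).mpr (minor_mem_minorsIdeal q s k), map_zero]
  let φ : MvPolynomial (Fin (n + 1)) ℂ →ₐ[ℂ] L := aeval fun k => c * ρ (X k)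
  have hφ : ∀ {e : ℕ} {G : MvPolynomial (Fin (n + 1)) ℂ}, G.IsHomogeneous e →
      φ G = c ^ e * ρ G := fun {e G} hG => by
    rw [hρ G]
    exact aeval_mul_of_isHomogeneous hG c _
  have hle : Ideal.span (Set.range (fixedPointEq t)) ≤ RingHom.ker φ := by
    rw [Ideal.span_le]
    rintro _ ⟨k, rfl⟩
    change φ (fixedPointEq t k) = 0
    rw [fixedPointEq, ← hq, map_sub, hφ (q k).2, hφ (isHomogeneous_X ℂ k)]
    have h1 : c * ρ (q k) = ρ (X k) := by
      linear_combination μ * hminor k + ρ (X k) * hμ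
    linear_combination c * h1
  have h0 : c ^ d * ρ F = 0 := by
    rw [← hφ hF]
    exact hle hFt
  have h1 : algebraMap A L (π (X s ^ d * F)) = 0 := by
    rw [← hρπ, map_mul, map_pow]
    have h2 : ρ (X s) = c * ρ (q s) := by linear_combination - ρ (X s) * hμ
    rw [h2, mul_pow]
    linear_combination ρ (q s) ^ d * h0
  obtain ⟨⟨_, M, rfl⟩, hM⟩ := (IsLocalization.map_eq_zero_iff (Submonoid.powers Q) L _).mp h1
  refine ⟨M, ?_⟩
  rw [← toCoordRing_eq_zero_iff, map_mul, map_pow]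
  exact hM

/-- The coordinate rings of the standard charts of the eigenscheme are reduced if the scheme of
fixed points is. -/
theorem isReduced_away_X (t : Fin (n + 1) × Fin (n + 1) × Fin (n + 1) → ℂ)
    (hq : ∀ k, (q k : MvPolynomial (Fin (n + 1)) ℂ) = contraction t k)
    (h0 : ∀ v : Fin (n + 1) → ℂ,
      (∀ k, eval v (q k : MvPolynomial (Fin (n + 1)) ℂ) = 0) → v = 0)
    [_root_.IsReduced (FixedPointAlgebra t)] (s : Fin (n + 1)) :
    _root_.IsReduced (HomogeneousLocalization.Away (quotGrading (minorsIdeal q))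
      (toCoordRing (minorsIdeal q) (X s))) := by
  refine ⟨fun z hz => ?_⟩
  have hX : toCoordRing (minorsIdeal q) (X s) ∈ quotGrading (minorsIdeal q) 1 :=
    mk_mem_quotGrading _ (isHomogeneous_X ℂ s)
  obtain ⟨k, a, ha, rfl⟩ := HomogeneousLocalization.Away.mk_surjective _ hX z
  obtain ⟨F, hF, rfl⟩ := exists_form_of_mem_quotGrading _ ha
  obtain ⟨m, hm⟩ := hz
  apply HomogeneousLocalization.val_injective
  have hm' := congrArg HomogeneousLocalization.val hm
  rw [HomogeneousLocalization.val_pow, HomogeneousLocalization.val_zero,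
    HomogeneousLocalization.Away.val_mk, Localization.mk_pow, Localization.mk_eq_mk',
    IsLocalization.mk'_eq_zero_iff] at hm'
  obtain ⟨⟨_, l, rfl⟩, hl⟩ := hm'
  rw [HomogeneousLocalization.val_zero, HomogeneousLocalization.Away.val_mk,
    Localization.mk_eq_mk', IsLocalization.mk'_eq_zero_iff]
  have hnil : (X s * F) ^ (l + m) ∈ (minorsIdeal q).toIdeal := by
    rw [← toCoordRing_eq_zero_iff]
    have h : (X s * F) ^ (l + m) = (X s ^ m * F ^ l) * (X s ^ l * F ^ m) := by ring
    rw [h, map_mul, map_mul _ (X s ^ l), map_pow _ _ l, map_pow _ F m]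
    exact mul_eq_zero_of_right _ hl
  have hmem : X s * F ∈ Ideal.span (Set.range (fixedPointEq t)) := by
    rw [← Ideal.Quotient.eq_zero_iff_mem]
    refine eq_zero_of_pow_eq_zero (n := l + m) ?_
    rw [← map_pow, Ideal.Quotient.eq_zero_iff_mem]
    exact minorsIdeal_le_span_fixedPointEq q t hq hnil
  obtain ⟨M, hM⟩ := exists_pow_mul_mem_minorsIdeal q t hq s
    ((isHomogeneous_X ℂ s).mul hF) hmem
  obtain ⟨N, b, hb⟩ := exists_X_pow_sub_mul_mem_minorsIdeal q h0 s
  rw [← toCoordRing_eq_zero_iff, map_sub, sub_eq_zero, map_pow, map_mul] at hb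
  rw [← toCoordRing_eq_zero_iff] at hM
  simp only [map_mul, map_pow] at hM
  refine ⟨⟨toCoordRing (minorsIdeal q) (X s) ^ (N * M + (1 + k • 1 + 1)), _, rfl⟩, ?_⟩
  change toCoordRing (minorsIdeal q) (X s) ^ (N * M + (1 + k • 1 + 1)) *
    toCoordRing (minorsIdeal q) F = 0
  rw [pow_add, pow_mul, hb]
  linear_combination toCoordRing (minorsIdeal q) b ^ M * hM

theorem isReduced_eigenscheme (t : Fin (n + 1) × Fin (n + 1) × Fin (n + 1) → ℂ)
    (hq : ∀ k, (q k : MvPolynomial (Fin (n + 1)) ℂ) = contraction t k)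
    (h0 : ∀ v : Fin (n + 1) → ℂ,
      (∀ k, eval v (q k : MvPolynomial (Fin (n + 1)) ℂ) = 0) → v = 0)
    [_root_.IsReduced (FixedPointAlgebra t)] : AlgebraicGeometry.IsReduced (eigenscheme q) := by
  let 𝒰 := (Proj.affineOpenCoverOfIrrelevantLESpan (quotGrading (minorsIdeal q))
    (fun s => toCoordRing (minorsIdeal q) (X s)) (m := fun _ => 1)
    (fun s => mk_mem_quotGrading _ (isHomogeneous_X ℂ s)) (fun _ => one_pos)
    (irrelevant_le_span_X _)).openCover
  have hred : ∀ s, AlgebraicGeometry.IsReduced (𝒰.X s) := fun s => by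
    have := isReduced_away_X q t hq h0 s
    change AlgebraicGeometry.IsReduced (Spec (.of (HomogeneousLocalization.Away
      (quotGrading (minorsIdeal q)) (toCoordRing (minorsIdeal q) (X s)))))
    infer_instance
  exact IsReduced.of_openCover _ 𝒰

/-- The entries of a partially symmetric tensor, indexed by triples. -/
def PartiallySymmetricTensor.entries (T : PartiallySymmetricTensor n)
    (a : Fin (n + 1) × Fin (n + 1) × Fin (n + 1)) : ℂ :=
  T.1 a.1 a.2.1 a.2.2

theorem PartiallySymmetricTensor.quadrics_eq_contraction (T : PartiallySymmetricTensor n)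
    (k : Fin (n + 1)) :
    (T.quadrics k : MvPolynomial (Fin (n + 1)) ℂ) = contraction T.entries k := rfl

/-- The tensor with `qₖ = xₖ²`, as a partially symmetric tensor. -/
def fermatTensor (n : ℕ) : PartiallySymmetricTensor n :=
  ⟨fun i j k => diagonalTensor (Fin (n + 1)) ℂ (i, j, k), fun i j k => by
    simp [diagonalTensor, and_comm]⟩

theorem natCard_normalizedEigenvectors (T : PartiallySymmetricTensor n) {N : ℕ}
    (hN : Nat.card (fixedPoints T.entries) = N) (hpos : N ≠ 0) :
    Finite (normalizedEigenvectors T.quadrics) ∧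
      Nat.card (normalizedEigenvectors T.quadrics) = N - 1 := by
  have hfin : (fixedPoints T.entries).Finite := by
    have : Finite (fixedPoints T.entries) := Nat.finite_of_card_ne_zero (hN ▸ hpos)
    exact Set.toFinite _
  have h0 : (0 : Fin (n + 1) → ℂ) ∈ fixedPoints T.entries := fun k => by
    rw [eval_contraction]
    simp
  have h : normalizedEigenvectors T.quadrics = fixedPoints T.entries \ {0} := by
    ext v
    exact and_comm
  rw [h]
  refine ⟨hfin.subset Set.sdiff_subset, ?_⟩
  rw [Nat.card_coe_set_eq, Set.ncard_sdiff_singleton_of_mem h0, ← Nat.card_coe_set_eq, hN]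

/-- The general eigenscheme consists of `2ⁿ⁺¹ - 1` reduced points. -/
theorem holdsForGeneral_eigenscheme (n : ℕ) :
    HoldsForGeneral n fun T =>
      ConsistsOfReducedPoints (eigenscheme T.quadrics) (2 ^ (n + 1) - 1) := by
  obtain ⟨D, hD, h⟩ := exists_polynomial_fixedPoints (Fin (n + 1))
  refine ⟨D, ⟨fermatTensor n, hD⟩, fun T hT => ?_⟩
  obtain ⟨h0, hcard, hred⟩ := h T.entries hT
  rw [Fintype.card_fin] at hcard
  obtain ⟨hfin, hcard'⟩ := natCard_normalizedEigenvectors T hcard (by positivity)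
  have hsurj := eigenpoint_surjective T.quadrics h0
  have hT1 := t1Space_eigenscheme T.quadrics hsurj
  have hfinE : Finite (eigenscheme T.quadrics) := Finite.of_surjective _ hsurj
  refine ⟨isReduced_eigenscheme _ T.entries T.quadrics_eq_contraction h0, inferInstance, hfinE, ?_⟩
  rw [← hcard']
  exact (Nat.card_eq_of_bijective _ ⟨eigenpoint_injective _, hsurj⟩).symm

end Reduced

/-! ### The point `[0, …, 0, 1]` of the scheme of eigenpairs -/

section LastPoint

variable {n : ℕ} (T : PartiallySymmetricTensor n)

/-- The matrix `λ - Q(x)` of linear forms, where `Q(x) x = q(x)`. It annihilates the vector `x` on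
the scheme of eigenpairs. -/
def pencilMatrix : Matrix (Fin (n + 1)) (Fin (n + 1)) (MvPolynomial (Fin (n + 2)) ℂ) :=
  fun k j => (if k = j then X (Fin.last (n + 1)) else 0) - ∑ i, C (T.1 i j k) * X i.castSucc

/-- The determinant of `λ - Q(x)`, a form of degree `n + 1` which is `1` at `[0, …, 0, 1]` and
annihilates `x₀, …, xₙ` on the scheme of eigenpairs. -/
def pencilDet : MvPolynomial (Fin (n + 2)) ℂ := (pencilMatrix T).det

theorem pencilDet_isHomogeneous : (pencilDet T).IsHomogeneous (n + 1) := by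
  have hM : ∀ k j, (pencilMatrix T k j).IsHomogeneous 1 := fun k j => by
    refine IsHomogeneous.sub ?_ (IsHomogeneous.sum _ _ _ fun i _ => ?_)
    · split_ifs
      · exact isHomogeneous_X ℂ _
      · exact isHomogeneous_zero _ _ _
    · simpa using (isHomogeneous_C (Fin (n + 2)) (T.1 i j k)).mul (isHomogeneous_X ℂ i.castSucc)
  rw [pencilDet, Matrix.det_apply]
  refine IsHomogeneous.sum _ _ _ fun τ _ => ?_
  have h := IsHomogeneous.prod Finset.univ (fun i => pencilMatrix T (τ i) i) (fun _ => 1)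
    (fun i _ => hM _ _)
  rw [Finset.sum_const, Finset.card_univ, Fintype.card_fin, smul_eq_mul, mul_one] at h
  rcases Int.units_eq_one_or (Equiv.Perm.sign τ) with hs | hs
  · rwa [hs, one_smul]
  · rw [hs, Units.neg_smul, one_smul]
    exact h.neg

theorem eval_pencilDet : eval (lastVec n) (pencilDet T) = 1 := by
  rw [pencilDet, RingHom.map_det]
  convert Matrix.det_one (n := Fin (n + 1)) (R := ℂ)
  ext k j
  have h : ∀ i : Fin (n + 1), lastVec n i.castSucc = 0 := fun i => by
    simp [lastVec, Fin.castSucc_ne_last]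
  have hl : lastVec n (Fin.last (n + 1)) = 1 := by simp [lastVec]
  simp only [RingHom.mapMatrix_apply, Matrix.map_apply, pencilMatrix, map_sub, map_sum, map_mul,
    eval_X, h, mul_zero, Finset.sum_const_zero, sub_zero, Matrix.one_apply]
  split_ifs
  · rw [eval_X, hl]
  · rw [map_zero]

theorem pencilMatrix_mulVec (k : Fin (n + 1)) :
    (pencilMatrix T).mulVec (fun j => X j.castSucc) k = X (Fin.last (n + 1)) * X k.castSucc -
      rename Fin.castSucc (T.quadrics k : MvPolynomial (Fin (n + 1)) ℂ) := by
  simp only [Matrix.mulVec, dotProduct, pencilMatrix, sub_mul, Finset.sum_sub_distrib, ite_mul,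
    zero_mul, Finset.sum_ite_eq, Finset.mem_univ, if_true, T.quadrics_eq_contraction, contraction,
    map_sum, map_mul, rename_C, rename_X, Finset.sum_mul, mul_assoc,
    PartiallySymmetricTensor.entries]
  rw [Finset.sum_comm]

theorem pencilDet_mul_X_mem (j : Fin (n + 1)) :
    pencilDet T * X j.castSucc ∈ (eigenpairIdeal T.quadrics).toIdeal := by
  have h := congrFun (congrArg (fun A : Matrix (Fin (n + 1)) (Fin (n + 1))
    (MvPolynomial (Fin (n + 2)) ℂ) => A.mulVec fun j => X j.castSucc)
    (Matrix.adjugate_mul (pencilMatrix T))) j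
  simp only [← Matrix.mulVec_mulVec, Matrix.smul_mulVec, Matrix.one_mulVec, Pi.smul_apply,
    smul_eq_mul] at h
  rw [pencilDet, ← h, Matrix.mulVec, dotProduct]
  refine Ideal.sum_mem _ fun k _ => Ideal.mul_mem_left _ _ ?_
  rw [pencilMatrix_mulVec, ← neg_mem_iff, neg_sub]
  exact Ideal.subset_span ⟨k, rfl⟩

theorem sub_mem_span_X_castSucc {d : ℕ} {F : MvPolynomial (Fin (n + 2)) ℂ}
    (hF : F.IsHomogeneous d) :
    F - C (eval (lastVec n) F) * X (Fin.last (n + 1)) ^ d ∈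
      Ideal.span (Set.range fun j : Fin (n + 1) =>
        (X j.castSucc : MvPolynomial (Fin (n + 2)) ℂ)) := by
  let J := Ideal.span (Set.range fun j : Fin (n + 1) =>
    (X j.castSucc : MvPolynomial (Fin (n + 2)) ℂ))
  let π : MvPolynomial (Fin (n + 2)) ℂ →ₐ[ℂ] MvPolynomial (Fin (n + 2)) ℂ ⧸ J :=
    Ideal.Quotient.mkₐ ℂ J
  have hX : ∀ s, π (X s) = π (X (Fin.last (n + 1))) * algebraMap ℂ _ (lastVec n s) := by
    intro s
    refine Fin.lastCases ?_ (fun j => ?_) s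
    · simp [lastVec]
    · have h0 : π (X j.castSucc) = 0 := Ideal.Quotient.eq_zero_iff_mem.mpr
        (Ideal.subset_span ⟨j, rfl⟩)
      rw [h0]
      simp [lastVec, Fin.castSucc_ne_last]
  have h1 : π F = π (X (Fin.last (n + 1))) ^ d * algebraMap ℂ _ (eval (lastVec n) F) := by
    have h2 : π F = aeval (fun s => π (X s)) F := by
      rw [← comp_aeval_apply, aeval_X_left_apply]
    rw [h2, funext hX, aeval_mul_of_isHomogeneous hF]
    congr 1
    exact aeval_algebraMap_apply _ _ _
  refine Ideal.Quotient.eq.mp ?_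
  change π F = π _
  rw [h1, map_mul, map_pow, mul_comm]
  rfl

/-- Multiplication by `det (λ - Q(x))` on the scheme of eigenpairs restricts forms to the point
`[0, …, 0, 1]`. -/
theorem pencilDet_mul_form {d : ℕ} {F : MvPolynomial (Fin (n + 2)) ℂ} (hF : F.IsHomogeneous d) :
    toCoordRing (eigenpairIdeal T.quadrics) (pencilDet T * F) =
      toCoordRing (eigenpairIdeal T.quadrics)
        (pencilDet T * (C (eval (lastVec n) F) * X (Fin.last (n + 1)) ^ d)) := by
  rw [← sub_eq_zero, ← map_sub, toCoordRing_eq_zero_iff, ← mul_sub]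
  have h := sub_mem_span_X_castSucc hF
  generalize F - _ = G at h
  induction h using Submodule.span_induction with
  | mem x hx =>
    obtain ⟨j, rfl⟩ := hx
    exact pencilDet_mul_X_mem T j
  | zero => simp
  | add x y _ _ hx hy => rw [mul_add]; exact add_mem hx hy
  | smul a x _ hx => rw [smul_eq_mul, mul_left_comm]; exact Ideal.mul_mem_left _ _ hx

theorem pencilDet_notMem_lastPoint :
    toCoordRing (eigenpairIdeal T.quadrics) (pencilDet T) ∉
      (lastPoint T.quadrics).asHomogeneousIdeal := by
  intro h
  have h1 := (mem_pointOf_iff _ _ _ (pencilDet_isHomogeneous T)).mp h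
  rw [eval_pencilDet] at h1
  exact one_ne_zero h1

theorem eq_lastPoint_of_pencilDet_notMem (p : eigenpairScheme T.quadrics)
    (hp : toCoordRing (eigenpairIdeal T.quadrics) (pencilDet T) ∉ p.asHomogeneousIdeal) :
    p = lastPoint T.quadrics := by
  refine eq_pointOf _ _ _ p fun d F hF hFv => ?_
  have h := pencilDet_mul_form T hF
  rw [hFv, C_0, zero_mul, mul_zero, map_zero, map_mul] at h
  have h1 : toCoordRing (eigenpairIdeal T.quadrics) (pencilDet T) *
      toCoordRing (eigenpairIdeal T.quadrics) F ∈ p.asHomogeneousIdeal.toIdeal := by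
    rw [h]
    exact zero_mem _
  exact (p.isPrime.mem_or_mem h1).resolve_left hp

/-- The scheme of eigenpairs is `Spec ℂ` in a neighbourhood of `[0, …, 0, 1]`. -/
theorem bijective_away_pencilDet :
    Function.Bijective ((HomogeneousLocalization.fromZeroRingHom
      (quotGrading (eigenpairIdeal T.quadrics))
      (Submonoid.powers (toCoordRing (eigenpairIdeal T.quadrics) (pencilDet T)))).comp
        (algebraMap ℂ (quotGrading (eigenpairIdeal T.quadrics) 0))) := by
  have hdeg := mk_mem_quotGrading (eigenpairIdeal T.quadrics) (pencilDet_isHomogeneous T)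
  constructor
  · have : Nontrivial (HomogeneousLocalization.Away (quotGrading (eigenpairIdeal T.quadrics))
        (toCoordRing (eigenpairIdeal T.quadrics) (pencilDet T))) := by
      refine ⟨1, 0, fun h => ?_⟩
      have h1 := congrArg HomogeneousLocalization.val h
      rw [HomogeneousLocalization.val_one, HomogeneousLocalization.val_zero,
        ← map_one (algebraMap (CoordRing (eigenpairIdeal T.quadrics)) _),
        IsLocalization.map_eq_zero_iff (Submonoid.powers (toCoordRing (eigenpairIdeal T.quadrics)
          (pencilDet T)))] at h1
      obtain ⟨⟨_, m, rfl⟩, hm⟩ := h1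
      rw [mul_one] at hm
      refine pencilDet_notMem_lastPoint T ((lastPoint T.quadrics).isPrime.mem_of_pow_mem m ?_)
      change _ ^ m = _ at hm
      rw [hm]
      exact zero_mem _
    exact RingHom.injective _
  · intro z
    obtain ⟨k, a, ha, rfl⟩ := HomogeneousLocalization.Away.mk_surjective _ hdeg z
    obtain ⟨F, hF, rfl⟩ := exists_form_of_mem_quotGrading _ ha
    refine ⟨eval (lastVec n) F, HomogeneousLocalization.val_injective _ ?_⟩
    rw [HomogeneousLocalization.Away.val_mk]
    change Localization.mk (toCoordRing (eigenpairIdeal T.quadrics) (C (eval (lastVec n) F))) 1 = _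
    rw [Localization.mk_eq_mk_iff, Localization.r_iff_exists]
    refine ⟨⟨toCoordRing (eigenpairIdeal T.quadrics) (pencilDet T), 1, pow_one _⟩, ?_⟩
    have h1 := pencilDet_mul_form T hF
    have h2 := pencilDet_mul_form T ((pencilDet_isHomogeneous T).pow k)
    rw [map_pow, eval_pencilDet, one_pow, C_1, one_mul] at h2
    rw [show k • (n + 1) = (n + 1) * k by rw [smul_eq_mul, mul_comm]] at h1
    simp only [map_mul, map_pow] at h1 h2 ⊢
    change toCoordRing (eigenpairIdeal T.quadrics) (pencilDet T) *
      (toCoordRing (eigenpairIdeal T.quadrics) (pencilDet T) ^ k *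
        toCoordRing (eigenpairIdeal T.quadrics) (C (eval (lastVec n) F))) =
      toCoordRing (eigenpairIdeal T.quadrics) (pencilDet T) *
        ((1 : CoordRing (eigenpairIdeal T.quadrics)) *
          toCoordRing (eigenpairIdeal T.quadrics) F)
    rw [one_mul, h1]
    linear_combination toCoordRing (eigenpairIdeal T.quadrics) (C (eval (lastVec n) F)) * h2

theorem isSmoothAt_lastPoint :
    IsSmoothAt (structureMorphism (eigenpairIdeal T.quadrics)) (lastPoint T.quadrics) := by
  let 𝒜 := quotGrading (eigenpairIdeal T.quadrics)
  let h := toCoordRing (eigenpairIdeal T.quadrics) (pencilDet T)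
  have hdeg : h ∈ 𝒜 (n + 1) := mk_mem_quotGrading _ (pencilDet_isHomogeneous T)
  refine ⟨Proj.basicOpen 𝒜 h, pencilDet_notMem_lastPoint T, ?_⟩
  have h1 : (Proj.basicOpen 𝒜 h).ι =
      (Proj.basicOpenIsoSpec 𝒜 h hdeg n.succ_pos).hom ≫ Proj.awayι 𝒜 h hdeg n.succ_pos := by
    rw [Proj.awayι, Iso.hom_inv_id_assoc]
  rw [h1, Category.assoc, structureMorphism, Proj.awayι_toSpecZero_assoc, ← Spec.map_comp,
    ← CommRingCat.ofHom_comp]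
  have h2 : IsIso (CommRingCat.ofHom ((HomogeneousLocalization.fromZeroRingHom 𝒜
      (Submonoid.powers h)).comp (algebraMap ℂ (𝒜 0)))) :=
    (ConcreteCategory.isIso_iff_bijective _).mpr (bijective_away_pencilDet T)
  infer_instance

theorem isOpen_singleton_lastPoint :
    IsOpen ({lastPoint T.quadrics} : Set (eigenpairScheme T.quadrics)) := by
  have h : ({lastPoint T.quadrics} : Set (eigenpairScheme T.quadrics)) =
      (Proj.basicOpen (quotGrading (eigenpairIdeal T.quadrics))
        (toCoordRing (eigenpairIdeal T.quadrics) (pencilDet T)) :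
          Set (eigenpairScheme T.quadrics)) := by
    ext p
    refine ⟨?_, fun hp => eq_lastPoint_of_pencilDet_notMem T p hp⟩
    rintro rfl
    exact pencilDet_notMem_lastPoint T
  rw [h]
  exact (Proj.basicOpen _ _).isOpen

end LastPoint

/-! ### Existence of eigenvectors and regular eigenpoints -/

section Existence

variable {n : ℕ}

/-- An eigenvector of any tensor is a limit of unit eigenvectors of general tensors on a line. -/
theorem exists_eigenvector (T : PartiallySymmetricTensor n) :
    ∃ v : Fin (n + 1) → ℂ, v ≠ 0 ∧ ∀ i j,
      v i * eval v (T.quadrics j : MvPolynomial (Fin (n + 1)) ℂ) =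
        v j * eval v (T.quadrics i : MvPolynomial (Fin (n + 1)) ℂ) := by
  obtain ⟨D, hD, hgen⟩ := exists_polynomial_fixedPoints (Fin (n + 1))
  -- The line through `T` and the tensor with `qₖ = xₖ²`.
  let line : ℂ → Fin (n + 1) × Fin (n + 1) × Fin (n + 1) → ℂ := fun ε a =>
    T.entries a + ε * (diagonalTensor (Fin (n + 1)) ℂ a - T.entries a)
  let P : Polynomial ℂ := aeval (fun a => Polynomial.C (T.entries a) +
    Polynomial.X * Polynomial.C (diagonalTensor (Fin (n + 1)) ℂ a - T.entries a)) D
  have hP : ∀ ε, P.eval ε = eval (line ε) D := fun ε => by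
    have h := comp_aeval_apply (fun a => Polynomial.C (T.entries a) +
      Polynomial.X * Polynomial.C (diagonalTensor (Fin (n + 1)) ℂ a - T.entries a))
      (Polynomial.aeval ε) D
    rw [Polynomial.coe_aeval_eq_eval] at h
    refine h.trans ?_
    simp [line, aeval_eq_eval]
  have hP0 : P ≠ 0 := by
    intro h
    have h1 := hP 1
    rw [h, Polynomial.eval_zero] at h1
    have h2 : line 1 = diagonalTensor (Fin (n + 1)) ℂ := by
      funext a
      simp [line]
    rw [h2] at h1
    exact hD h1.symm
  let good : Set ℂ := {ε | eval (line ε) D ≠ 0}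
  have hgood : Dense good := by
    have h : good = (↑P.roots.toFinset : Set ℂ)ᶜ := by
      ext ε
      simp [good, ← hP, hP0]
    rw [h]
    exact P.roots.toFinset.finite_toSet.countable.dense_compl ℂ
  let K : Set (ℂ × (Fin (n + 1) → ℂ)) := {x | ∀ i j,
    x.2 i * eval x.2 (contraction (line x.1) j) = x.2 j * eval x.2 (contraction (line x.1) i)}
  have hK : IsClosed K := by
    have h : K = ⋂ i, ⋂ j, {x | x.2 i * eval x.2 (contraction (line x.1) j) =
        x.2 j * eval x.2 (contraction (line x.1) i)} := by
      ext x
      simp [K]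
    rw [h]
    refine isClosed_iInter fun i => isClosed_iInter fun j => isClosed_eq ?_ ?_ <;>
    · simp only [eval_contraction, line]
      fun_prop
  -- The parameters with a unit eigenvector form a closed set, as the unit sphere is compact.
  have hclosed : IsClosed {ε | ∃ v : Fin (n + 1) → ℂ, ‖v‖ = 1 ∧ (ε, v) ∈ K} := by
    have hproj := (isClosedMap_fst_of_compactSpace (X := ℂ)
      (Y := Metric.sphere (0 : Fin (n + 1) → ℂ) 1)) {x | (x.1, x.2.1) ∈ K}
      (hK.preimage (by fun_prop))
    convert hproj using 1
    ext ε
    constructor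
    · rintro ⟨v, hv, hvK⟩
      exact ⟨(ε, ⟨v, by simpa using hv⟩), hvK, rfl⟩
    · rintro ⟨⟨ε', v, hv⟩, hvK, rfl⟩
      exact ⟨v, by simpa using hv, hvK⟩
  have hsub : good ⊆ {ε | ∃ v : Fin (n + 1) → ℂ, ‖v‖ = 1 ∧ (ε, v) ∈ K} := by
    intro ε hε
    obtain ⟨-, hcard, -⟩ := hgen (line ε) hε
    have hnt : (fixedPoints (line ε)).Nontrivial := by
      refine (Set.one_lt_ncard_iff_nontrivial_and_finite.mp ?_).1
      rw [← Nat.card_coe_set_eq, hcard, Fintype.card_fin]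
      exact Nat.one_lt_two_pow (Nat.succ_ne_zero n)
    obtain ⟨v, hv, hv0⟩ := hnt.exists_ne 0
    have hnorm : ‖v‖ ≠ 0 := norm_ne_zero_iff.mpr hv0
    refine ⟨((‖v‖ : ℂ)⁻¹) • v, ?_, fun i j => ?_⟩
    · rw [norm_smul, norm_inv, Complex.norm_real, norm_norm, inv_mul_cancel₀ hnorm]
    · simp only [eval_smul_of_isHomogeneous (contraction_isHomogeneous _ _), Pi.smul_apply,
        smul_eq_mul, hv i, hv j]
      ring
  have hall := hclosed.closure_subset_iff.mpr hsub (hgood.closure_eq ▸ Set.mem_univ (0 : ℂ))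
  obtain ⟨v, hv, hvK⟩ := hall
  refine ⟨v, ?_, fun i j => ?_⟩
  · rintro rfl
    simp at hv
  · have h0 : line 0 = T.entries := by
      funext a
      simp [line]
    have h := hvK i j
    rwa [h0] at h

theorem nonempty_eigenscheme (T : PartiallySymmetricTensor n) :
    Nonempty (eigenscheme T.quadrics) := by
  obtain ⟨v, hv, h⟩ := exists_eigenvector T
  exact ⟨pointOf _ v hv (eval_eq_zero_of_mem_minorsIdeal _ h)⟩

theorem pderiv_pderiv_comm {σ : Type} (i j : σ) (F : MvPolynomial σ ℂ) :
    pderiv i (pderiv j F) = pderiv j (pderiv i F) := by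
  classical
  have h : ⁅(pderiv i : Derivation ℂ (MvPolynomial σ ℂ) (MvPolynomial σ ℂ)),
      (pderiv j : Derivation ℂ (MvPolynomial σ ℂ) (MvPolynomial σ ℂ))⁆ = 0 := by
    refine derivation_ext fun k => ?_
    rw [Derivation.commutator_apply]
    simp [pderiv_X, Pi.single_apply, apply_ite]
  have h1 := DFunLike.congr_fun h F
  rwa [Derivation.commutator_apply, Derivation.zero_apply, sub_eq_zero] at h1

/-- Every tuple of quadratic forms comes from a partially symmetric tensor, whose slices are half of
the Hessian matrices. -/
theorem exists_quadrics_eq (q : Fin (n + 1) → Quadric n) :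
    ∃ T : PartiallySymmetricTensor n, T.quadrics = q := by
  let T : PartiallySymmetricTensor n := ⟨fun i j k => 2⁻¹ * coeff 0 (pderiv i (pderiv j
    (q k : MvPolynomial (Fin (n + 1)) ℂ))), fun i j k => by simp only [pderiv_pderiv_comm i j]⟩
  refine ⟨T, funext fun k => Subtype.ext ?_⟩
  have hq : (q k : MvPolynomial (Fin (n + 1)) ℂ).IsHomogeneous 2 := (q k).2
  have hC : ∀ i j, pderiv i (pderiv j (q k : MvPolynomial (Fin (n + 1)) ℂ)) =
      C (coeff 0 (pderiv i (pderiv j (q k : MvPolynomial (Fin (n + 1)) ℂ)))) := fun i j => by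
    have h : (pderiv i (pderiv j (q k : MvPolynomial (Fin (n + 1)) ℂ))).IsHomogeneous 0 :=
      hq.pderiv.pderiv
    exact totalDegree_eq_zero_iff_eq_C.mp (Nat.le_zero.mp h.totalDegree_le)
  have h1 : ∀ j, ∑ i, X i * pderiv i (pderiv j (q k : MvPolynomial (Fin (n + 1)) ℂ)) =
      pderiv j (q k : MvPolynomial (Fin (n + 1)) ℂ) := fun j => by
    have h : (pderiv j (q k : MvPolynomial (Fin (n + 1)) ℂ)).IsHomogeneous 1 := hq.pderiv
    rw [h.sum_X_mul_pderiv, one_smul]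
  have h2 := hq.sum_X_mul_pderiv
  have h3 : C (2⁻¹ : ℂ) * (2 • (q k : MvPolynomial (Fin (n + 1)) ℂ)) =
      (q k : MvPolynomial (Fin (n + 1)) ℂ) := by
    rw [← Nat.cast_smul_eq_nsmul ℂ, ← smul_eq_C_mul, smul_smul]
    norm_num
  refine Eq.trans ?_ h3
  rw [← h2, Finset.mul_sum, PartiallySymmetricTensor.quadrics_eq_contraction, contraction,
    Finset.sum_comm]
  refine Finset.sum_congr rfl fun j _ => ?_
  rw [← h1 j, Finset.mul_sum, Finset.mul_sum]
  refine Finset.sum_congr rfl fun i _ => ?_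
  rw [hC i j, PartiallySymmetricTensor.entries, C_mul]
  ring

/-- A regular eigenpoint of a smooth cubic: by Euler's formula the gradient of a smooth cubic has no
zero, so every eigenvector has a non-zero eigenvalue. -/
theorem exists_regular_eigenvector (f : homogeneousSubmodule (Fin (n + 1)) ℂ 3)
    (hf : IsSmoothCubic f) :
    ∃ v : Fin (n + 1) → ℂ, v ≠ 0 ∧ ∃ c : ℂ, c ≠ 0 ∧
      ∀ i, eval v (pderiv i (f : MvPolynomial (Fin (n + 1)) ℂ)) = c * v i := by
  obtain ⟨T, hT⟩ := exists_quadrics_eq (gradient f)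
  obtain ⟨v, hv, h⟩ := exists_eigenvector T
  rw [hT] at h
  obtain ⟨c, hc⟩ := exists_smul_of_mul_eq_mul
    (w := fun i => eval v (pderiv i (f : MvPolynomial (Fin (n + 1)) ℂ))) hv h
  refine ⟨v, hv, c, ?_, fun i => congrFun hc i⟩
  rintro rfl
  have hgrad : ∀ i, eval v (pderiv i (f : MvPolynomial (Fin (n + 1)) ℂ)) = 0 := fun i => by
    simpa using congrFun hc i
  have heuler := congrArg (eval v) (IsHomogeneous.sum_X_mul_pderiv (φ := f.1) f.2)
  simp only [map_sum, map_mul, hgrad, mul_zero, Finset.sum_const_zero, map_nsmul] at heuler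
  have hfv : eval v (f : MvPolynomial (Fin (n + 1)) ℂ) = 0 :=
    (smul_eq_zero.mp heuler.symm).resolve_left (by norm_num)
  obtain ⟨i, hi⟩ := hf v hv hfv
  exact hi (hgrad i)

/-- An eigenvector at which the quadrics do not all vanish is a point of the regular
eigenscheme. -/
theorem nonempty_regularEigenscheme (q : Fin (n + 1) → Quadric n) {v : Fin (n + 1) → ℂ}
    (hv : v ≠ 0) (hI : ∀ F ∈ minorsIdeal q, eval v F = 0) {i : Fin (n + 1)}
    (hi : eval v (q i : MvPolynomial (Fin (n + 1)) ℂ) ≠ 0) :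
    Nonempty (regularEigenscheme q) := by
  refine ⟨pointOf _ v hv fun F hF => ?_⟩
  have hF' : F ∈ (minorsIdeal q).toIdeal.colon
    ((irregularIdeal q).toIdeal : Set (MvPolynomial (Fin (n + 1)) ℂ)) := hF
  have h := hI _ (Submodule.mem_colon.mp hF' (q i) (Ideal.subset_span ⟨i, rfl⟩))
  rw [smul_eq_mul, map_mul] at h
  exact (mul_eq_zero.mp h).resolve_right hi

end Existence

end Eigenscheme

end

theorem mainTheorem5 (n : ℕ) :
    Eigenscheme.HoldsForGeneral n (fun T =>
      Eigenscheme.ConsistsOfReducedPoints (Eigenscheme.eigenscheme T.quadrics) (2 ^ (n + 1) - 1)) ∧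
    (∀ T : Eigenscheme.PartiallySymmetricTensor n,
      Eigenscheme.IsSmoothAt
        (Eigenscheme.structureMorphism (Eigenscheme.eigenpairIdeal T.quadrics))
        (Eigenscheme.lastPoint T.quadrics) ∧
      IsOpen ({Eigenscheme.lastPoint T.quadrics} :
        Set (Eigenscheme.eigenpairScheme T.quadrics)) ∧
      Nonempty (Eigenscheme.eigenscheme T.quadrics)) ∧
    (∀ f : MvPolynomial.homogeneousSubmodule (Fin (n + 1)) ℂ 3, Eigenscheme.IsSmoothCubic f →
      Nonempty (Eigenscheme.regularEigenscheme (Eigenscheme.gradient f)) ∧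
      ∃ v : Fin (n + 1) → ℂ, v ≠ 0 ∧ ∃ c : ℂ, c ≠ 0 ∧
        ∀ i, MvPolynomial.eval v (MvPolynomial.pderiv i (f : MvPolynomial (Fin (n + 1)) ℂ)) =
          c * v i) := by
  refine ⟨Eigenscheme.holdsForGeneral_eigenscheme n, fun T =>
    ⟨Eigenscheme.isSmoothAt_lastPoint T, Eigenscheme.isOpen_singleton_lastPoint T,
      Eigenscheme.nonempty_eigenscheme T⟩, fun f hf => ?_⟩
  obtain ⟨v, hv, c, hc, h⟩ := Eigenscheme.exists_regular_eigenvector f hf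
  obtain ⟨i, hi⟩ := Function.ne_iff.mp hv
  refine ⟨Eigenscheme.nonempty_regularEigenscheme (i := i) _ hv
    (Eigenscheme.eval_eq_zero_of_mem_minorsIdeal _ fun j k => ?_) ?_, v, hv, c, hc, h⟩
  · change v j * eval v (pderiv k _) = v k * eval v (pderiv j _)
    rw [h, h]
    ring
  · change eval v (pderiv i _) ≠ 0
    rw [h]
    exact mul_ne_zero hc hi
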